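/- Proposition 5.3. There is an absolute constant $C>0$ with the following property. Let $k\ge 1$, let $\mathcal J_1,\dots,\mathcal J_k$ be finite subsets of $\mathbb N_+$, let $\mathcal I=\bigcup_{i=1}^k \{i\}\times\mathcal J_i$, and let $\{X_{ij}:(i,j)\in\mathcal I\}$ be real random variables on a common probability space with $\mathbb E X_{ij}=0$ and $\mathbb E|X_{ij}|^4<\infty$. Suppose that: (LD-D1) for every $(i,j)\in\mathcal I$ a set $A_{i,j}\subset\mathcal J_i$ is given such that $X_{ij}$ is independent of the family $\{X_{pq}:(p,q)\in\mathcal I,\ (p,q)\notin\{i\}\times A_{i,j}\}$; (LD-D2) for every $(i,j)\in\mathcal I$ and $l\in A_{i,j}$ a set $A_{i,jl}$ with $A_{i,j}\subset A_{i,jl}\subset\mathcal J_i$ is given such that $\{X_{ij},X_{il}\}$ is independent of the family $\{X_{pq}:(p,q)\in\mathcal I,\ (p,q)\notin\{i\}\times A_{i,jl}\}$. Let $N_{i,j}=\{(i,q): q\in\mathcal J_i,\ j\in A_{i,q}\}$ and, with suprema over the empty set equal to $0$, $$\kappa_i=\max\Big\{\sup_{j\in\mathcal J_i}|N_{i,j}|,\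 \sup_{j\in\mathcal J_i,\ l\in A_{i,j}}|A_{i,jl}|\Big\},\qquad \tau_i=\max_{j\in\mathcal J_i}\big|\{(p,q)\in\mathcal J_i\times\mathcal J_i:\ q\in A_{i,p},\ j\in A_{i,pq}\}\big|.$$ Let $S=\sum_{i=1}^k\sum_{j\in\mathcal J_i}X_{ij}$ and $\sigma=\sqrt{\mathrm{Var}(S)}$, and assume $\sigma>0$. Then, with $\|X\|_4=(\mathbb E|X|^4)^{1/4}$ and $\Phi$ the distribution function of $N(0,1)$, $$\sup_{z\in\mathbb R}\big|\mathbb P(S/\sigma\le z)-\Phi(z)\big|\le \frac{C}{\sigma^3}\sum_{i=1}^k\sum_{j\in\mathcal J_i}\kappa_i^2\|X_{ij}\|_4^3+\frac{C}{\sigma^2}\Big(\sum_{i=1}^k\sum_{j\in\mathcal J_i}(\kappa_i^3+\kappa_i\tau_i)\|X_{ij}\|_4^4\Big)^{1/2}.$$ -/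

import Mathlib

open MeasureTheory ProbabilityTheory

noncomputable section

/-- The index set `⋃ i, {i} × (J i)` of a block-structured family. -/
def blockIndex {k : ℕ} (J : Fin k → Finset ℕ+) : Set (Fin k × ℕ+) :=
  {t | t.2 ∈ J t.1}

/-- The indices that are in the index set but outside `{i} × B`: every index of the
other blocks, and the indices `(i, q)` of block `i` with `q ∉ B`. -/
def outsideBlock {k : ℕ} (J : Fin k → Finset ℕ+) (i : Fin k) (B : Finset ℕ+) :
    Set (Fin k × ℕ+) :=
  {t | t ∈ blockIndex J ∧ ¬ (t.1 = i ∧ t.2 ∈ B)}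

/-- The family `(X p q)` indexed by a set `T` of pairs, as one random element of `T → ℝ`. -/
def subfamily {k : ℕ} {Ω : Type*} (X : Fin k → ℕ+ → Ω → ℝ) (T : Set (Fin k × ℕ+)) :
    Ω → T → ℝ :=
  fun ω t => X t.1.1 t.1.2 ω

/-- Condition (LD-D1): for each index `(i, j)`, the neighbourhood `A i j` lies in `J i`, and
`X i j` is independent of the family of all variables with index outside `{i} × A i j`. -/
def LDD1 {k : ℕ} {Ω : Type*} [MeasurableSpace Ω] (μ : Measure Ω)
    (J : Fin k → Finset ℕ+) (X : Fin k → ℕ+ → Ω → ℝ)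
    (A : Fin k → ℕ+ → Finset ℕ+) : Prop :=
  ∀ i, ∀ j ∈ J i, A i j ⊆ J i ∧
    IndepFun (X i j) (subfamily X (outsideBlock J i (A i j))) μ

/-- Condition (LD-D2): for each index `(i, j)` and each `l ∈ A i j`, the second-order
neighbourhood `A₂ i j l` satisfies `A i j ⊆ A₂ i j l ⊆ J i`, and the pair `(X i j, X i l)` is
independent of the family of all variables with index outside `{i} × A₂ i j l`. -/
def LDD2 {k : ℕ} {Ω : Type*} [MeasurableSpace Ω] (μ : Measure Ω)
    (J : Fin k → Finset ℕ+) (X : Fin k → ℕ+ → Ω → ℝ)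
    (A : Fin k → ℕ+ → Finset ℕ+) (A₂ : Fin k → ℕ+ → ℕ+ → Finset ℕ+) : Prop :=
  ∀ i, ∀ j ∈ J i, ∀ l ∈ A i j, A i j ⊆ A₂ i j l ∧ A₂ i j l ⊆ J i ∧
    IndepFun (fun ω => (X i j ω, X i l ω)) (subfamily X (outsideBlock J i (A₂ i j l))) μ

/-- The second coordinates of `N_{i,j} = {(i, q) : q ∈ J i, j ∈ A i q}`. -/
def blockN {k : ℕ} (J : Fin k → Finset ℕ+) (A : Fin k → ℕ+ → Finset ℕ+)
    (i : Fin k) (j : ℕ+) : Finset ℕ+ :=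
  {q ∈ J i | j ∈ A i q}

/-- `κ_i`, the larger of `sup_j |N_{i,j}|` and `sup_{j, l ∈ A i j} |A₂ i j l|`
(a supremum over the empty set is `0`). -/
def blockKappa {k : ℕ} (J : Fin k → Finset ℕ+) (A : Fin k → ℕ+ → Finset ℕ+)
    (A₂ : Fin k → ℕ+ → ℕ+ → Finset ℕ+) (i : Fin k) : ℕ :=
  max ((J i).sup fun j => (blockN J A i j).card)
    ((J i).sup fun j => (A i j).sup fun l => (A₂ i j l).card)

/-- `τ_i = max_j |{(p, q) ∈ J i × J i : q ∈ A i p, j ∈ A₂ i p q}|`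
(a maximum over the empty set is `0`). -/
def blockTau {k : ℕ} (J : Fin k → Finset ℕ+) (A : Fin k → ℕ+ → Finset ℕ+)
    (A₂ : Fin k → ℕ+ → ℕ+ → Finset ℕ+) (i : Fin k) : ℕ :=
  (J i).sup fun j =>
    (((J i) ×ˢ (J i)).filter fun pq => pq.2 ∈ A i pq.1 ∧ j ∈ A₂ i pq.1 pq.2).card

/-- The sum `S` of all variables of the family. -/
def blockSum {k : ℕ} {Ω : Type*} (J : Fin k → Finset ℕ+) (X : Fin k → ℕ+ → Ω → ℝ) : Ω → ℝ :=
  fun ω => ∑ i, ∑ j ∈ J i, X i j ω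

/-- The standard deviation `σ = √Var(S)`. -/
def blockSigma {k : ℕ} {Ω : Type*} [MeasurableSpace Ω] (μ : Measure Ω)
    (J : Fin k → Finset ℕ+) (X : Fin k → ℕ+ → Ω → ℝ) : ℝ :=
  √(variance (blockSum J X) μ)

end

/-! ### The Stein equation for bounded continuous test functions -/

/-! The proof is Stein's method with a bootstrap on the Kolmogorov distance `δ`. Write `W = S/σ = ∑
ξ_j`, `Y_j = ∑_{l ∈ A j} ξ_l`, `T = ∑ ξ_j Y_j`, and let `h` be a ramp of width `α` with Stein
solution `f`. Since `ξ_j` is centred and independent of `W - Y_j`, `E h(W) - E h(Z) = E f'(W)(1 - T)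
- ∑ E ξ_j r_j`, where `Z` is standard normal and `r_j = f(W) - f(W - Y_j) - Y_j f'(W)`.

The first term is small because `E T = E W² = 1` and `Var T` is a sum of covariances of pair
functions. Such a covariance vanishes unless one index of the second pair lies in the second-order
neighbourhood of the first pair; counting the rest yields the weights `κ³ + κτ`
(`variance_sum_pairs_le`).

In `r_j` the smooth part costs third moments, with weights `κ²`, and fourth moments. The rough part
is an increment of the ramp over distance `|Y_j|`, which forces `W` to be near `z`. Conditioning `W`
on `Y_j` is avoided: the increment is dominated by a sum over scales `s = α 4 ^ k` of the indicator
of `|W - z| ≤ 2s` times a convex function `ladder α k` of `|Y_j|` (`exists_ramp_increment_bound`).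
Convexity splits the function of `Y_j` into functions of single `ξ_l` (`ladder_abs_sum_le`), so what
multiplies the indicator is again a sum of pair functions with variance at most `4β²`. It can
therefore be decoupled from the indicator (`integral_indicator_mul_le`), whose mean is at most `5s +
2δ`. The sums over scales are geometric and give `388 β (1 + δ/α)`.

Smoothing adds `α`. With `α = 800 β` the coefficient of `δ` on the right is below `1/2`, and the
inequality can be solved for `δ` (`LocallyDependent.abs_measureReal_sub_cdf_le`). -/

theorem hasDerivAt_gaussianPDFReal_std (x : ℝ) :
    HasDerivAt (gaussianPDFReal 0 1) (-x * gaussianPDFReal 0 1 x) x := by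
  rw [gaussianPDFReal_def]
  have h1 : HasDerivAt (fun x : ℝ => -(x - 0) ^ 2 / (2 * ((1 : NNReal) : ℝ))) (-x) x := by
    have := (((hasDerivAt_id x).sub_const 0).pow 2).neg.div_const (2 * ((1 : NNReal) : ℝ))
    refine this.congr_deriv ?_
    simp
    ring
  have h2 := (h1.exp).const_mul (√(2 * Real.pi * ((1 : NNReal) : ℝ)))⁻¹
  refine h2.congr_deriv ?_
  ring

theorem tendsto_gaussianPDFReal_std_atTop :
    Filter.Tendsto (gaussianPDFReal 0 1) Filter.atTop (nhds 0) := by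
  have h1 : Filter.Tendsto (fun x : ℝ => x ^ 2 / 2) Filter.atTop Filter.atTop :=
    (Filter.tendsto_pow_atTop (by norm_num)).atTop_div_const (by norm_num)
  have h2 := (Real.tendsto_exp_neg_atTop_nhds_zero.comp h1).const_mul
    (√(2 * Real.pi * ((1 : NNReal) : ℝ)))⁻¹
  rw [mul_zero] at h2
  refine h2.congr fun x => ?_
  simp [gaussianPDFReal, neg_div]

theorem gaussianPDFReal_std_neg (x : ℝ) : gaussianPDFReal 0 1 (-x) = gaussianPDFReal 0 1 x := by
  simp [gaussianPDFReal]

/-- Mills ratio bound: on the tail `w ≤ x`, and `x p(x)` is the derivative of `-p`. -/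
theorem mul_integral_Ioi_gaussianPDFReal_le {w : ℝ} (hw : 0 ≤ w) :
    w * ∫ x in Set.Ioi w, gaussianPDFReal 0 1 x ≤ gaussianPDFReal 0 1 w := by
  have hd : ∀ x ∈ Set.Ici w, HasDerivAt (fun x => -gaussianPDFReal 0 1 x)
      (x * gaussianPDFReal 0 1 x) x := fun x _ =>
    (hasDerivAt_gaussianPDFReal_std x).neg.congr_deriv (by ring)
  have ht : Filter.Tendsto (fun x => -gaussianPDFReal 0 1 x) Filter.atTop (nhds 0) := by
    simpa using tendsto_gaussianPDFReal_std_atTop.neg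
  have hpos : ∀ x ∈ Set.Ioi w, 0 ≤ x * gaussianPDFReal 0 1 x := fun x hx =>
    mul_nonneg (hw.trans (le_of_lt hx)) (gaussianPDFReal_nonneg 0 1 x)
  have hint := integrableOn_Ioi_deriv_of_nonneg' hd hpos ht
  have heq := integral_Ioi_of_hasDerivAt_of_tendsto' hd hint ht
  have hle : ∫ x in Set.Ioi w, w * gaussianPDFReal 0 1 x
      ≤ ∫ x in Set.Ioi w, x * gaussianPDFReal 0 1 x := by
    refine setIntegral_mono_on ((integrable_gaussianPDFReal 0 1).const_mul w).integrableOn hint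
      measurableSet_Ioi fun x hx => ?_
    exact mul_le_mul_of_nonneg_right (le_of_lt hx) (gaussianPDFReal_nonneg 0 1 x)
  rw [integral_const_mul, heq] at hle
  linarith

theorem neg_mul_integral_Iic_gaussianPDFReal_le {w : ℝ} (hw : w ≤ 0) :
    -w * ∫ x in Set.Iic w, gaussianPDFReal 0 1 x ≤ gaussianPDFReal 0 1 w := by
  have h := mul_integral_Ioi_gaussianPDFReal_le (w := -w) (by linarith)
  rw [← integral_comp_neg_Iic] at h
  simpa only [gaussianPDFReal_std_neg] using h

theorem abs_setIntegral_mul_gaussianPDFReal_le {g : ℝ → ℝ}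
    (hb : ∀ x, |g x| ≤ 1) (s : Set ℝ) :
    |∫ x in s, g x * gaussianPDFReal 0 1 x| ≤ ∫ x in s, gaussianPDFReal 0 1 x := by
  rw [← Real.norm_eq_abs]
  refine norm_integral_le_of_norm_le (integrable_gaussianPDFReal 0 1).integrableOn
    (Filter.Eventually.of_forall fun x => ?_)
  rw [Real.norm_eq_abs, abs_mul, abs_of_nonneg (gaussianPDFReal_nonneg 0 1 x)]
  exact mul_le_of_le_one_left (gaussianPDFReal_nonneg 0 1 x) (hb x)

theorem inv_gaussianPDFReal_std_le {w : ℝ} (hw : |w| ≤ 1) : (gaussianPDFReal 0 1 w)⁻¹ ≤ 5 := by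
  have h1 : (gaussianPDFReal 0 1 w)⁻¹ = √(2 * Real.pi) * Real.exp (w ^ 2 / 2) := by
    simp [gaussianPDFReal, neg_div, Real.exp_neg, mul_comm]
  rw [h1]
  have h2 : w ^ 2 / 2 ≤ 1 / 2 := by nlinarith [abs_le.1 hw, sq_abs w, abs_nonneg w]
  have h3 : Real.exp (1 / 2) ≤ 1.7 := by
    have : Real.exp (1 / 2) ^ 2 = Real.exp 1 := by
      rw [← Real.exp_nat_mul]; norm_num
    nlinarith [Real.exp_one_lt_d9, Real.exp_pos (1 / 2)]
  have h4 : √(2 * Real.pi) ≤ 2.6 :=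
    Real.sqrt_le_iff.2 ⟨by norm_num, by nlinarith [Real.pi_lt_d2]⟩
  calc √(2 * Real.pi) * Real.exp (w ^ 2 / 2)
      ≤ 2.6 * 1.7 := mul_le_mul h4 ((Real.exp_le_exp.2 h2).trans h3) (Real.exp_pos _).le
        (by norm_num)
    _ ≤ 5 := by norm_num

/-- The solution is `f = G / p` with `G w` the integral of `(h - c) p` up to `w`. Mills' bound gives
`|w f w| ≤ 1`, hence `|f'| ≤ 2`. It also bounds `f` for `|w| ≥ 1`; for `|w| ≤ 1` the bound `1/p ≤ 5`
is used. -/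
theorem exists_stein_solution {h : ℝ → ℝ} (hc : Continuous h) (h0 : ∀ x, 0 ≤ h x)
    (h1 : ∀ x, h x ≤ 1) :
    ∃ f f' : ℝ → ℝ, (∀ w, HasDerivAt f (f' w) w) ∧
      (∀ w, f' w = w * f w + h w - ∫ x, h x ∂(gaussianReal 0 1)) ∧
      (∀ w, |f w| ≤ 5) ∧ (∀ w, |f' w| ≤ 2) := by
  set c := ∫ x, h x ∂(gaussianReal 0 1) with hcdef
  set p := gaussianPDFReal 0 1 with hp
  have hppos : ∀ x, 0 < p x := fun x => gaussianPDFReal_pos 0 1 x one_ne_zero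
  have hpint : Integrable p := integrable_gaussianPDFReal 0 1
  have hpc : Continuous p := by rw [hp, gaussianPDFReal_def]; fun_prop
  have hhint : Integrable h (gaussianReal 0 1) :=
    Integrable.of_bound hc.aestronglyMeasurable 1
      (Filter.Eventually.of_forall fun x => by
        rw [Real.norm_eq_abs, abs_of_nonneg (h0 x)]; exact h1 x)
  have hc0 : 0 ≤ c := integral_nonneg h0
  have hc1 : c ≤ 1 := by
    calc c ≤ ∫ _, (1 : ℝ) ∂(gaussianReal 0 1) := integral_mono hhint (integrable_const _) h1
      _ = 1 := by simp
  have hgb : ∀ x, |h x - c| ≤ 1 := fun x =>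
    abs_le.2 ⟨by linarith [h0 x], by linarith [h1 x]⟩
  have hgc : Continuous fun x => h x - c := by fun_prop
  set g : ℝ → ℝ := fun x => (h x - c) * p x with hg
  have hgcont : Continuous g := hgc.mul hpc
  have hgint : Integrable g := by
    refine hpint.mono' hgcont.aestronglyMeasurable (Filter.Eventually.of_forall fun x => ?_)
    rw [hg, Real.norm_eq_abs, abs_mul, abs_of_pos (hppos x)]
    exact mul_le_of_le_one_left (hppos x).le (hgb x)
  have hg0 : ∫ x, g x = 0 := by
    have e1 : ∫ x, (h x - c) ∂(gaussianReal 0 1) = 0 := by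
      rw [integral_sub hhint (integrable_const _)]
      simp [hcdef]
    rw [integral_gaussianReal_eq_integral_smul one_ne_zero] at e1
    rw [← e1]
    refine integral_congr_ae (Filter.Eventually.of_forall fun x => ?_)
    simp only [hg, hp, smul_eq_mul]
    ring
  set G : ℝ → ℝ := fun w => ∫ x in Set.Iic w, g x with hG
  have hGd : ∀ w, HasDerivAt G (g w) w := by
    intro w
    have e : G = fun u => G w + ∫ x in w..u, g x := by
      funext u
      have := intervalIntegral.integral_Iic_sub_Iic (a := w) (b := u) (μ := volume) (f := g)
        hgint.integrableOn hgint.integrableOn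
      simp only [hG]
      linarith
    rw [e]
    exact (intervalIntegral.integral_hasDerivAt_right (hgint.intervalIntegrable)
      (hgcont.stronglyMeasurableAtFilter _ _) hgcont.continuousAt).const_add _
  have hG1 : ∀ w, |G w| ≤ ∫ x in Set.Iic w, p x := fun w =>
    abs_setIntegral_mul_gaussianPDFReal_le hgb _
  -- Because `h - c` has Gaussian mean zero, `G` is also minus the integral over the upper tail;
  -- each half-line then uses its own thin tail.
  have hG2 : ∀ w, |G w| ≤ ∫ x in Set.Ioi w, p x := fun w => by
    have : G w = -∫ x in Set.Ioi w, g x := by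
      have := intervalIntegral.integral_Iic_add_Ioi (b := w) (μ := volume) (f := g)
        hgint.integrableOn hgint.integrableOn
      simp only [hG]
      linarith
    rw [this, abs_neg]
    exact abs_setIntegral_mul_gaussianPDFReal_le hgb _
  have hGle : ∀ w, |w| * |G w| ≤ p w := by
    intro w
    rcases le_total 0 w with hw | hw
    · rw [abs_of_nonneg hw]
      exact (mul_le_mul_of_nonneg_left (hG2 w) hw).trans (mul_integral_Ioi_gaussianPDFReal_le hw)
    · rw [abs_of_nonpos hw]
      exact (mul_le_mul_of_nonneg_left (hG1 w) (by linarith)).trans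
        (neg_mul_integral_Iic_gaussianPDFReal_le hw)
  have hG3 : ∀ w, |G w| ≤ 1 := fun w => by
    refine (hG1 w).trans ?_
    rw [← integral_gaussianPDFReal_eq_one 0 one_ne_zero]
    exact setIntegral_le_integral hpint (Filter.Eventually.of_forall fun x => (hppos x).le)
  have hfabs : ∀ w, |(p w)⁻¹ * G w| = (p w)⁻¹ * |G w| := fun w => by
    rw [abs_mul, abs_of_pos (inv_pos.2 (hppos w))]
  have hwf : ∀ w, |w * ((p w)⁻¹ * G w)| ≤ 1 := fun w => by
    rw [abs_mul, hfabs]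
    have := mul_le_mul_of_nonneg_left (hGle w) (inv_pos.2 (hppos w)).le
    rw [inv_mul_cancel₀ (hppos w).ne'] at this
    linarith
  refine ⟨fun w => (p w)⁻¹ * G w, fun w => w * ((p w)⁻¹ * G w) + h w - c, ?_, fun w => rfl, ?_, ?_⟩
  · intro w
    refine (((hasDerivAt_gaussianPDFReal_std w).inv (hppos w).ne').mul (hGd w)).congr_deriv ?_
    have := (hppos w).ne'
    simp only [hg, ← hp, Pi.inv_apply]
    field_simp
    ring
  · intro w
    rcases le_total |w| 1 with hw | hw
    · change |(p w)⁻¹ * G w| ≤ 5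
      rw [hfabs]
      exact (mul_le_of_le_one_right (inv_pos.2 (hppos w)).le (hG3 w)).trans
        (inv_gaussianPDFReal_std_le hw)
    · have h2 := hwf w
      rw [abs_mul] at h2
      change |(p w)⁻¹ * G w| ≤ 5
      nlinarith [abs_nonneg ((p w)⁻¹ * G w)]
  · intro w
    have h2 := hwf w
    have h3 := hgb w
    change |w * ((p w)⁻¹ * G w) + h w - c| ≤ 2
    rw [add_sub_assoc]
    exact (abs_add_le _ _).trans (by linarith)

/-! ### The ramp function and the Taylor remainder of the Stein solution -/

/-- The continuous function equal to `1` up to `z`, to `0` after `z + α`, and affine between. -/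
noncomputable def ramp (z α w : ℝ) : ℝ := max 0 (min 1 (1 - (w - z) / α))

theorem continuous_ramp (z α : ℝ) : Continuous (ramp z α) := by
  unfold ramp
  fun_prop

theorem ramp_nonneg (z α w : ℝ) : 0 ≤ ramp z α w := le_max_left _ _

theorem ramp_le_one (z α w : ℝ) : ramp z α w ≤ 1 := max_le zero_le_one (min_le_left _ _)

theorem ramp_of_le {z α w : ℝ} (hα : 0 < α) (hw : w ≤ z) : ramp z α w = 1 := by
  have : 0 ≤ (z - w) / α := div_nonneg (by linarith) hα.le
  have h2 : 1 - (w - z) / α = 1 + (z - w) / α := by ring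
  rw [ramp, min_eq_left (by rw [h2]; linarith), max_eq_right zero_le_one]

theorem ramp_of_ge {z α w : ℝ} (hα : 0 < α) (hw : z + α ≤ w) : ramp z α w = 0 := by
  have : 1 ≤ (w - z) / α := (one_le_div hα).2 (by linarith)
  rw [ramp, max_eq_left]
  exact (min_le_right _ _).trans (by linarith)

theorem abs_ramp_sub_le_one (z α u w : ℝ) : |ramp z α u - ramp z α w| ≤ 1 :=
  abs_le.2 ⟨by linarith [ramp_nonneg z α u, ramp_le_one z α w],
    by linarith [ramp_nonneg z α w, ramp_le_one z α u]⟩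

theorem abs_ramp_sub_le {z α : ℝ} (hα : 0 < α) (u w : ℝ) :
    |ramp z α u - ramp z α w| ≤ |u - w| / α := by
  have key : ∀ a b : ℝ, |max 0 (min 1 a) - max 0 (min 1 b)| ≤ |a - b| := fun a b => by
    have h1 := abs_max_sub_max_le_max 0 (min 1 a) 0 (min 1 b)
    have h2 := abs_min_sub_min_le_max 1 a 1 b
    simp only [sub_self, abs_zero, abs_nonneg, sup_of_le_right] at h1 h2
    exact h1.trans h2
  refine (key _ _).trans (le_of_eq ?_)
  have : 1 - (u - z) / α - (1 - (w - z) / α) = -((u - w) / α) := by ring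
  rw [this, abs_neg, abs_div, abs_of_pos hα]

theorem ramp_eq_of_lt {z α u w y : ℝ} (hα : 0 < α) (hu : |u - w| ≤ y) (hw : y + α < |w - z|) :
    ramp z α u = ramp z α w := by
  rcases abs_le.1 hu with ⟨h1, h2⟩
  rcases lt_abs.1 hw with h | h
  · rw [ramp_of_ge hα (by linarith), ramp_of_ge hα (by linarith)]
  · rw [ramp_of_le hα (by linarith), ramp_of_le hα (by linarith)]

/-- The ramp is only Lipschitz, so no second derivative of `f` is used. The Stein equation itself
expresses an increment of `f'` through increments of `w f` and of the ramp, and the mean value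
inequality does the rest. -/
theorem stein_remainder_le {z α : ℝ} {f f' : ℝ → ℝ} {c : ℝ}
    (hd : ∀ w, HasDerivAt f (f' w) w) (heq : ∀ w, f' w = w * f w + ramp z α w - c)
    (hf : ∀ w, |f w| ≤ 5) (hf' : ∀ w, |f' w| ≤ 2) (w y D : ℝ)
    (hD : ∀ u, |u - w| ≤ |y| → |ramp z α u - ramp z α w| ≤ D) :
    |f w - f (w - y) - y * f' w| ≤ y ^ 2 * (2 * |w| + 5) + |y| * D := by
  have hlip : ∀ u, |f u - f w| ≤ 2 * |u - w| := fun u => by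
    have := Convex.norm_image_sub_le_of_norm_hasDerivWithin_le (f := f) (f' := f') (C := 2)
      (s := Set.univ) (fun x _ => (hd x).hasDerivWithinAt) (fun x _ => hf' x) convex_univ
      (Set.mem_univ w) (Set.mem_univ u)
    simpa using this
  have hdiff : ∀ u, |u - w| ≤ |y| → |f' u - f' w| ≤ |y| * (2 * |w| + 5) + D := by
    intro u hu
    have e : f' u - f' w = w * (f u - f w) + (u - w) * f u + (ramp z α u - ramp z α w) := by
      rw [heq u, heq w]; ring
    rw [e]
    refine (abs_add_le _ _).trans (add_le_add ((abs_add_le _ _).trans ?_) (hD u hu))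
    rw [abs_mul, abs_mul]
    have e1 : |w| * |f u - f w| ≤ |w| * (2 * |y|) :=
      mul_le_mul_of_nonneg_left ((hlip u).trans (by linarith)) (abs_nonneg w)
    have e2 : |u - w| * |f u| ≤ |y| * 5 := mul_le_mul hu (hf u) (abs_nonneg _) (abs_nonneg _)
    linarith
  have hmain : |(f w - f (w - y) - y * f' w)| ≤ (|y| * (2 * |w| + 5) + D) * |y| := by
    -- This path runs from `f (w - y)` to `f w - y f' w`; its derivative is `y` times an increment
    -- of `f'`.
    have hk : ∀ t ∈ Set.Icc (0 : ℝ) 1, HasDerivWithinAt (fun t => f (w - y + t * y) - t * y * f' w)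
        (y * (f' (w - y + t * y) - f' w)) (Set.Icc 0 1) t := by
      intro t _
      have a1 : HasDerivAt (fun t : ℝ => w - y + t * y) y t := by
        simpa using ((hasDerivAt_id t).mul_const y).const_add (w - y)
      have a2 : HasDerivAt (fun t : ℝ => t * y * f' w) (y * f' w) t := by
        simpa using ((hasDerivAt_id t).mul_const y).mul_const (f' w)
      refine (((hd _).comp t a1).sub a2).hasDerivWithinAt.congr_deriv ?_
      ring
    have := Convex.norm_image_sub_le_of_norm_hasDerivWithin_le
      (C := (|y| * (2 * |w| + 5) + D) * |y|) hk (fun t ht => ?_) (convex_Icc 0 1)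
      (Set.left_mem_Icc.2 zero_le_one) (Set.right_mem_Icc.2 zero_le_one)
    · simp only [Real.norm_eq_abs] at this
      convert this using 1
      · congr 1
        ring_nf
      · simp
    · rw [Real.norm_eq_abs, abs_mul, mul_comm]
      refine mul_le_mul_of_nonneg_right (hdiff _ ?_) (abs_nonneg y)
      have : w - y + t * y - w = -((1 - t) * y) := by ring
      rw [this, abs_neg, abs_mul, abs_of_nonneg (by linarith [ht.2])]
      exact mul_le_of_le_one_left (abs_nonneg y) (by linarith [ht.1])
  refine hmain.trans (le_of_eq ?_)
  rw [← sq_abs y]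
  ring

/-! ### A ladder of convex functions dominating the increments of the ramp -/

/-- Convex functions on `[0, ∞)` attached to the scales `α 4 ^ k`. -/
noncomputable def ladder (α : ℝ) : ℕ → ℝ → ℝ
  | 0, x => 2 * x ^ 2 / (α + x)
  | k + 1, x => 2 * max 0 (x - α * 4 ^ k / 2)

theorem measurable_ladder (α : ℝ) (k : ℕ) : Measurable (ladder α k) := by
  cases k with
  | zero => unfold ladder; fun_prop
  | succ k => unfold ladder; fun_prop

theorem ladder_nonneg {α : ℝ} (hα : 0 < α) (k : ℕ) {x : ℝ} (hx : 0 ≤ x) : 0 ≤ ladder α k x := by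
  cases k with
  | zero => simp only [ladder]; positivity
  | succ k => simp only [ladder]; positivity

/-- Linear growth keeps products with `|ξ_j|` below `2 |ξ_j ξ_l|`, so fourth moments control their
variances. This is why level `0` has denominator `α + x` rather than `α`. -/
theorem ladder_le {α : ℝ} (hα : 0 < α) (k : ℕ) {x : ℝ} (hx : 0 ≤ x) :
    ladder α k x ≤ 2 * x := by
  cases k with
  | zero =>
    simp only [ladder]
    rw [div_le_iff₀ (by linarith)]
    nlinarith [mul_nonneg hx hα.le]
  | succ k =>
    simp only [ladder]
    have : 0 ≤ α * 4 ^ k / 2 := by positivity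
    have := max_le hx (show x - α * 4 ^ k / 2 ≤ x by linarith)
    linarith

/-- Jensen's inequality for a convex function vanishing at `0`, with at most `K` summands. It
reduces a function of a neighbourhood sum to functions of single variables. -/
theorem ladder_abs_sum_le {ι : Type*} {α : ℝ} (hα : 0 < α) (k : ℕ) (s : Finset ι) {K : ℝ}
    (hs : (s.card : ℝ) ≤ K) (x : ι → ℝ) :
    ladder α k |∑ l ∈ s, x l| ≤ ∑ l ∈ s, K⁻¹ * ladder α k (K * |x l|) := by
  rcases s.eq_empty_or_nonempty with rfl | hne
  · cases k with
    | zero => simp [ladder]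
    | succ k =>
      have : 0 ≤ α * 4 ^ k / 2 := by positivity
      simp [ladder, this]
  have hcard : 0 < (s.card : ℝ) := by exact_mod_cast hne.card_pos
  have hK : 0 < K := hcard.trans_le hs
  have habs : |∑ l ∈ s, x l| ≤ ∑ l ∈ s, |x l| := Finset.abs_sum_le_sum_abs _ _
  set y := |∑ l ∈ s, x l| with hy
  have hy0 : 0 ≤ y := abs_nonneg _
  cases k with
  | zero =>
    simp only [ladder]
    have hS : 0 ≤ ∑ l ∈ s, |x l| := Finset.sum_nonneg fun _ _ => abs_nonneg _
    have h1 : y ^ 2 / (α + y) ≤ (∑ l ∈ s, |x l|) ^ 2 / (α + ∑ l ∈ s, |x l|) := by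
      rw [div_le_div_iff₀ (by linarith) (by linarith)]
      have : 0 ≤ (∑ l ∈ s, |x l|) - y := by linarith
      have e : (∑ l ∈ s, |x l|) ^ 2 * (α + y) - y ^ 2 * (α + ∑ l ∈ s, |x l|)
        = ((∑ l ∈ s, |x l|) - y) * (α * (∑ l ∈ s, |x l|) + α * y + (∑ l ∈ s, |x l|) * y) := by ring
      have : 0 ≤ ((∑ l ∈ s, |x l|) - y) *
          (α * (∑ l ∈ s, |x l|) + α * y + (∑ l ∈ s, |x l|) * y) := by positivity
      linarith
    have h2 : (α + ∑ l ∈ s, |x l|) = ∑ l ∈ s, (α / s.card + |x l|) := by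
      rw [Finset.sum_add_distrib, Finset.sum_const, nsmul_eq_mul]
      field_simp
    -- Sedrakyan's inequality, after spreading `α` evenly over the summands of the denominator.
    have h3 := Finset.sq_sum_div_le_sum_sq_div s (fun l => |x l|) (g := fun l => α / s.card + |x l|)
      (fun l _ => by positivity)
    rw [← h2] at h3
    have h4 : ∀ l ∈ s, 2 * (|x l| ^ 2 / (α / s.card + |x l|))
        ≤ K⁻¹ * (2 * (K * |x l|) ^ 2 / (α + K * |x l|)) := by
      intro l _
      have hx := abs_nonneg (x l)
      have e : K⁻¹ * (2 * (K * |x l|) ^ 2 / (α + K * |x l|))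
          = 2 * (|x l| ^ 2 / (α / K + |x l|)) := by
        field_simp
      rw [e]
      gcongr
    calc 2 * y ^ 2 / (α + y) = 2 * (y ^ 2 / (α + y)) := by ring
      _ ≤ 2 * ∑ l ∈ s, |x l| ^ 2 / (α / s.card + |x l|) := by linarith
      _ = ∑ l ∈ s, 2 * (|x l| ^ 2 / (α / s.card + |x l|)) := Finset.mul_sum _ _ _
      _ ≤ _ := Finset.sum_le_sum h4
  | succ k =>
    simp only [ladder]
    set c := α * 4 ^ k / 2 with hc
    have hc0 : 0 ≤ c := by positivity
    have h1 : ∀ l ∈ s, |x l| - c / K ≤ K⁻¹ * max 0 (K * |x l| - c) := by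
      intro l _
      have : K⁻¹ * (K * |x l| - c) = |x l| - c / K := by field_simp
      rw [← this]
      exact mul_le_mul_of_nonneg_left (le_max_right _ _) (by positivity)
    have h2 : (∑ l ∈ s, |x l|) - c ≤ ∑ l ∈ s, (|x l| - c / K) := by
      rw [Finset.sum_sub_distrib, Finset.sum_const, nsmul_eq_mul]
      have : (s.card : ℝ) * (c / K) ≤ c := by
        rw [mul_div_assoc', div_le_iff₀ hK]
        nlinarith
      linarith
    have h3 : max 0 (y - c) ≤ ∑ l ∈ s, K⁻¹ * max 0 (K * |x l| - c) :=
      max_le (Finset.sum_nonneg fun l _ => by positivity)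
        (by linarith [Finset.sum_le_sum h1])
    calc 2 * max 0 (y - c) ≤ 2 * ∑ l ∈ s, K⁻¹ * max 0 (K * |x l| - c) := by linarith
      _ = _ := by rw [Finset.mul_sum]; exact Finset.sum_congr rfl fun _ _ => by ring

/-- The powers of `4` below `x` form a geometric sum. The bound `α 4 ^ N` in the minimum is what
carries the induction. -/
theorem sum_scales_lt_le {α x : ℝ} (hx : 0 ≤ x) (N : ℕ) (hα : 0 < α) :
    ∑ k ∈ Finset.range N, (if α * 4 ^ k < x then α * 4 ^ k else 0) ≤ min (α * 4 ^ N) (2 * x) := by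
  induction N with
  | zero => simp [hα.le, hx]
  | succ N ih =>
    rw [Finset.sum_range_succ]
    have hp : 0 < α * 4 ^ N := by positivity
    have e : α * 4 ^ (N + 1) = 4 * (α * 4 ^ N) := by ring
    have h1 := ih.trans (min_le_left _ _)
    have h2 := ih.trans (min_le_right _ _)
    rw [e]
    split_ifs with h
    · exact le_min (by linarith) (by linarith)
    · exact le_min (by linarith) (by linarith)

/-- A positive level vanishes until `x` exceeds half of the previous scale, so only scales up to
order `x` contribute, each at most a multiple of `x` times its scale. The constant is `2` from level
`0` plus `8 · 4` from the others. -/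
theorem sum_scale_mul_ladder_le {α x : ℝ} (hα : 0 < α) (hx : 0 ≤ x) (N : ℕ) :
    ∑ k ∈ Finset.range (N + 1), α * 4 ^ k * ladder α k x ≤ 34 * x ^ 2 := by
  rw [Finset.sum_range_succ']
  have h0 : α * 4 ^ 0 * ladder α 0 x ≤ 2 * x ^ 2 := by
    simp only [ladder, pow_zero, mul_one]
    rw [mul_div_assoc', div_le_iff₀ (by linarith)]
    nlinarith [mul_nonneg hx (sq_nonneg x)]
  have h1 : ∀ k ∈ Finset.range N, α * 4 ^ (k + 1) * ladder α (k + 1) x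
      ≤ 8 * x * (if α * 4 ^ k < 2 * x then α * 4 ^ k else 0) := by
    intro k _
    have hp : 0 < α * 4 ^ k := by positivity
    simp only [ladder]
    split_ifs with h
    · have : max 0 (x - α * 4 ^ k / 2) ≤ x := max_le hx (by linarith)
      rw [pow_succ]
      nlinarith
    · rw [max_eq_left (by linarith)]
      simp
  have h2 := Finset.sum_le_sum h1
  rw [← Finset.mul_sum] at h2
  have h3 := (sum_scales_lt_le (α := α) (x := 2 * x) (by linarith) N hα).trans (min_le_right _ _)
  nlinarith

theorem sum_two_pow_le (N : ℕ) : ∑ k ∈ Finset.range N, (2 : ℝ) ^ k ≤ 2 ^ N := by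
  rw [geom_sum_eq (by norm_num)]
  norm_num

/-- The increments of the ramp over distance `|y|`, times `|y|`, are dominated by the ladder. -/
theorem exists_ramp_increment_bound {z α : ℝ} (hα : 0 < α) {N : ℕ} (hN : 1 ≤ α * 4 ^ N)
    (w y : ℝ) : ∃ D : ℝ, (∀ u, |u - w| ≤ |y| → |ramp z α u - ramp z α w| ≤ D) ∧
      |y| * D ≤ y ^ 2 + ∑ k ∈ Finset.range (N + 1),
        (if |w - z| ≤ 2 * (α * 4 ^ k) then 1 else 0) * ladder α k |y| := by
  have hnn : ∀ k ∈ Finset.range (N + 1),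
      0 ≤ (if |w - z| ≤ 2 * (α * 4 ^ k) then (1 : ℝ) else 0) * ladder α k |y| := fun k _ =>
    mul_nonneg (by split_ifs <;> norm_num) (ladder_nonneg hα k (abs_nonneg y))
  have hsum := Finset.sum_nonneg hnn
  have hsq : |y| * |y| = y ^ 2 := by rw [← sq_abs y]; ring
  -- Beyond this distance the ramp is constant on the whole interval around `w` of radius `|y|`, so
  -- `D = 0` works.
  by_cases hw : |w - z| ≤ |y| + α
  · rcases le_total |y| α with hy | hy
    · refine ⟨|y| / α, fun u hu => (abs_ramp_sub_le hα u w).trans (by gcongr), ?_⟩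
      have h0 := Finset.single_le_sum hnn (Finset.mem_range.2 (Nat.succ_pos N))
      rw [if_pos (by simp; linarith)] at h0
      have : |y| * (|y| / α) ≤ ladder α 0 |y| := by
        simp only [ladder]
        rw [mul_div_assoc', div_le_div_iff₀ hα (by linarith [abs_nonneg y])]
        nlinarith [mul_nonneg (abs_nonneg y) (mul_nonneg (abs_nonneg y) (sub_nonneg.2 hy))]
      nlinarith [sq_nonneg y]
    · refine ⟨1, fun u _ => abs_ramp_sub_le_one z α u w, ?_⟩
      rw [mul_one]
      rcases le_or_gt 1 |y| with h1 | h1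
      · nlinarith
      -- With `α 4 ^ k ≤ |y| < α 4 ^ (k + 1)`, level `k + 1` alone exceeds `|y|`, and `|y| + α` is
      -- within its indicator radius. For `|y| ≥ 1` the term `y ^ 2` suffices, so finitely many
      -- levels are enough.
      · obtain ⟨k, hk1, hk2⟩ := exists_nat_pow_near (x := |y| / α) (y := 4)
          ((one_le_div hα).2 hy) (by norm_num)
        rw [le_div_iff₀ hα, mul_comm] at hk1
        rw [div_lt_iff₀ hα, mul_comm] at hk2
        have hkN : k < N := by
          by_contra hcon
          have : α * 4 ^ N ≤ α * 4 ^ k :=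
            mul_le_mul_of_nonneg_left (pow_le_pow_right₀ (by norm_num) (not_lt.1 hcon)) hα.le
          linarith
        have h0 := Finset.single_le_sum hnn (Finset.mem_range.2 (Nat.succ_lt_succ hkN))
        rw [Nat.succ_eq_add_one, if_pos (by linarith)] at h0
        have : |y| ≤ ladder α (k + 1) |y| := by
          simp only [ladder]
          have := le_max_right 0 (|y| - α * 4 ^ k / 2)
          linarith
        nlinarith [sq_nonneg y]
  · refine ⟨0, fun u hu => ?_, ?_⟩
    · rw [ramp_eq_of_lt hα hu (not_le.1 hw), sub_self, abs_zero]
    · rw [mul_zero]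
      positivity

/-! ### Random variables of polynomial growth in a dominating variable -/

/-- `f` is measurable and `|f| ≤ C (1 + Q) ^ n` for some constant `C ≥ 0`. -/
def PolyGrowth {Ω : Type*} [MeasurableSpace Ω] (Q : Ω → ℝ) (n : ℕ) (f : Ω → ℝ) : Prop :=
  Measurable f ∧ ∃ C, 0 ≤ C ∧ ∀ ω, |f ω| ≤ C * (1 + |Q ω|) ^ n

namespace PolyGrowth

variable {Ω : Type*} [MeasurableSpace Ω] {Q f g : Ω → ℝ} {n m : ℕ}

theorem mono (hf : PolyGrowth Q n f) (h : n ≤ m) : PolyGrowth Q m f := by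
  obtain ⟨h1, C, h2, h3⟩ := hf
  refine ⟨h1, C, h2, fun ω => (h3 ω).trans (mul_le_mul_of_nonneg_left ?_ h2)⟩
  exact pow_le_pow_right₀ (by linarith [abs_nonneg (Q ω)]) h

theorem mul (hf : PolyGrowth Q n f) (hg : PolyGrowth Q m g) :
    PolyGrowth Q (n + m) fun ω => f ω * g ω := by
  obtain ⟨h1, C, h2, h3⟩ := hf
  obtain ⟨k1, D, k2, k3⟩ := hg
  refine ⟨h1.mul k1, C * D, by positivity, fun ω => ?_⟩
  rw [abs_mul, pow_add]
  refine (mul_le_mul (h3 ω) (k3 ω) (abs_nonneg _) (by positivity)).trans (le_of_eq (by ring))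

theorem add (hf : PolyGrowth Q n f) (hg : PolyGrowth Q n g) :
    PolyGrowth Q n fun ω => f ω + g ω := by
  obtain ⟨h1, C, h2, h3⟩ := hf
  obtain ⟨k1, D, k2, k3⟩ := hg
  refine ⟨h1.add k1, C + D, by positivity, fun ω => (abs_add_le _ _).trans ?_⟩
  linarith [h3 ω, k3 ω]

theorem abs (hf : PolyGrowth Q n f) : PolyGrowth Q n fun ω => |f ω| := by
  obtain ⟨h1, C, h2, h3⟩ := hf
  exact ⟨h1.abs, C, h2, fun ω => by rw [abs_abs]; exact h3 ω⟩

theorem of_bounded (hf : Measurable f) (C : ℝ) (h : ∀ ω, |f ω| ≤ C) : PolyGrowth Q 0 f :=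
  ⟨hf, |C|, abs_nonneg _, fun ω => by simpa using (h ω).trans (le_abs_self C)⟩

theorem const (c : ℝ) : PolyGrowth Q n fun _ => c :=
  (of_bounded measurable_const |c| fun _ => le_rfl).mono (Nat.zero_le n)

theorem neg (hf : PolyGrowth Q n f) : PolyGrowth Q n fun ω => -f ω := by
  obtain ⟨h1, C, h2, h3⟩ := hf
  exact ⟨h1.neg, C, h2, fun ω => by rw [abs_neg]; exact h3 ω⟩

theorem sub (hf : PolyGrowth Q n f) (hg : PolyGrowth Q n g) :
    PolyGrowth Q n fun ω => f ω - g ω := by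
  simpa only [sub_eq_add_neg] using hf.add hg.neg

theorem pow (hf : PolyGrowth Q n f) (k : ℕ) : PolyGrowth Q (n * k) fun ω => f ω ^ k := by
  induction k with
  | zero => simpa using const (Q := Q) 1
  | succ k ih => simpa only [pow_succ, mul_add, mul_one] using ih.mul hf

theorem const_mul (c : ℝ) (hf : PolyGrowth Q n f) : PolyGrowth Q n fun ω => c * f ω := by
  simpa using (const (Q := Q) (n := 0) c).mul hf

theorem sum {ι : Type*} {F : ι → Ω → ℝ} (s : Finset ι) (h : ∀ i ∈ s, PolyGrowth Q n (F i)) :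
    PolyGrowth Q n fun ω => ∑ i ∈ s, F i ω := by
  classical
  induction s using Finset.induction_on with
  | empty => simpa using const (Q := Q) 0
  | insert a s ha ih =>
    simp only [Finset.sum_insert ha]
    exact (h a (Finset.mem_insert_self a s)).add
      (ih fun i hi => h i (Finset.mem_insert_of_mem hi))

theorem of_le (hf : Measurable f) (hg : PolyGrowth Q n g) (h : ∀ ω, |f ω| ≤ |g ω|) :
    PolyGrowth Q n f := by
  obtain ⟨_, D, k2, k3⟩ := hg
  exact ⟨hf, D, k2, fun ω => (h ω).trans (k3 ω)⟩

variable {μ : Measure Ω} [IsProbabilityMeasure μ]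

theorem integrable (hf : PolyGrowth Q n f) (hQ : MemLp Q 4 μ) (hn : n ≤ 4) : Integrable f μ := by
  obtain ⟨h1, C, h2, h3⟩ := hf.mono hn
  have hQ' : MemLp (fun ω => 1 + |Q ω|) 4 μ := (memLp_const (1 : ℝ)).add hQ.abs
  have hint : Integrable (fun ω => (1 + |Q ω|) ^ 4) μ := by
    refine (hQ'.integrable_norm_pow (p := 4) (by norm_num)).congr
      (Filter.Eventually.of_forall fun ω => ?_)
    simp only [Real.norm_eq_abs]
    rw [abs_of_nonneg (by positivity)]
  exact (hint.const_mul C).mono' h1.aestronglyMeasurable (Filter.Eventually.of_forall h3)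

theorem memLp_two (hf : PolyGrowth Q n f) (hQ : MemLp Q 4 μ) (hn : n ≤ 2) : MemLp f 2 μ :=
  (memLp_two_iff_integrable_sq hf.1.aestronglyMeasurable).2
    ((hf.pow 2).integrable hQ (by omega))

end PolyGrowth

/-! ### Local dependence -/

/-- Local dependence with first and second order neighbourhoods `A j` and `A₂ j l`, whose sizes
are controlled by `κ` and `τ`; both are constant along neighbourhoods. -/
structure LocallyDependent {ι Ω : Type*} [Fintype ι] [DecidableEq ι] [MeasurableSpace Ω]
    (μ : Measure Ω) (ξ : ι → Ω → ℝ) (A : ι → Finset ι) (A₂ : ι → ι → Finset ι)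
    (κ τ : ι → ℝ) : Prop where
  measurable : ∀ j, Measurable (ξ j)
  memLp : ∀ j, MemLp (ξ j) 4 μ
  integral_eq_zero : ∀ j, ∫ ω, ξ j ω ∂μ = 0
  indep_compl : ∀ j, IndepFun (ξ j) (fun ω => ∑ l ∈ (A j)ᶜ, ξ l ω) μ
  indep_pair_compl : ∀ j, ∀ l ∈ A j,
    IndepFun (fun ω => (ξ j ω, ξ l ω)) (fun ω => ∑ m ∈ (A₂ j l)ᶜ, ξ m ω) μ
  indep_pair_pair : ∀ j, ∀ l ∈ A j, ∀ p ∉ A₂ j l, ∀ q ∉ A₂ j l,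
    IndepFun (fun ω => (ξ j ω, ξ l ω)) (fun ω => (ξ p ω, ξ q ω)) μ
  card_le : ∀ j, ((A j).card : ℝ) ≤ κ j
  card_second_le : ∀ j, ∀ l ∈ A j, ((A₂ j l).card : ℝ) ≤ κ j
  card_inv_le : ∀ j, ((Finset.univ.filter fun q => j ∈ A q).card : ℝ) ≤ κ j
  card_pairs_le : ∀ j,
    ((Finset.univ.filter fun t : ι × ι => t.2 ∈ A t.1 ∧ j ∈ A₂ t.1 t.2).card : ℝ) ≤ τ j
  kappa_eq : ∀ j, ∀ l ∈ A j, κ l = κ j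
  kappa_second_eq : ∀ j, ∀ l ∈ A j, ∀ m ∈ A₂ j l, κ m = κ j
  tau_eq : ∀ j, ∀ l ∈ A j, τ l = τ j

/-- The sum of a family over a neighbourhood. -/
def nbhdSum {ι Ω : Type*} (ξ : ι → Ω → ℝ) (s : Finset ι) (ω : Ω) : ℝ := ∑ l ∈ s, ξ l ω

namespace LocallyDependent

variable {ι Ω : Type*} [Fintype ι] [DecidableEq ι] [MeasurableSpace Ω]
  {μ : Measure Ω} {ξ : ι → Ω → ℝ} {A : ι → Finset ι} {A₂ : ι → ι → Finset ι} {κ τ : ι → ℝ}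

variable (H : LocallyDependent μ ξ A A₂ κ τ)
include H

theorem kappa_nonneg (j : ι) : 0 ≤ κ j := (Nat.cast_nonneg _).trans (H.card_le j)

theorem tau_nonneg (j : ι) : 0 ≤ τ j := (Nat.cast_nonneg _).trans (H.card_pairs_le j)

theorem kappa_pos {j l : ι} (hl : l ∈ A j) : 0 < κ j :=
  lt_of_lt_of_le (by exact_mod_cast Finset.card_pos.2 ⟨l, hl⟩) (H.card_le j)

end LocallyDependent

/-! ### Counting sums over neighbourhoods. -/

theorem sum_relation_left_le {ι : Type*} [Fintype ι] {B : ι → Finset ι} {κ w : ι → ℝ}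
    (hB : ∀ j, ((B j).card : ℝ) ≤ κ j) (hw : ∀ j, 0 ≤ w j) :
    ∑ j, ∑ _l ∈ B j, w j ≤ ∑ j, κ j * w j := by
  refine Finset.sum_le_sum fun j _ => ?_
  rw [Finset.sum_const, nsmul_eq_mul]
  exact mul_le_mul_of_nonneg_right (hB j) (hw j)

theorem sum_relation_right_le {ι : Type*} [Fintype ι] [DecidableEq ι] {B : ι → Finset ι}
    {κ w : ι → ℝ} (hB : ∀ j, ((Finset.univ.filter fun q => j ∈ B q).card : ℝ) ≤ κ j)
    (hw : ∀ j, 0 ≤ w j) :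
    ∑ j, ∑ l ∈ B j, w l ≤ ∑ j, κ j * w j := by
  rw [Finset.sum_comm' (t' := Finset.univ) (s' := fun l => Finset.univ.filter fun q => l ∈ B q)
    (by simp)]
  refine Finset.sum_le_sum fun j _ => ?_
  rw [Finset.sum_const, nsmul_eq_mul]
  exact mul_le_mul_of_nonneg_right (hB j) (hw j)

namespace LocallyDependent

variable {ι Ω : Type*} [Fintype ι] [DecidableEq ι] [MeasurableSpace Ω]
  {μ : Measure Ω} {ξ : ι → Ω → ℝ} {A : ι → Finset ι} {A₂ : ι → ι → Finset ι} {κ τ : ι → ℝ}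

section Counting

variable (H : LocallyDependent μ ξ A A₂ κ τ) {w : ι → ℝ} (hw : ∀ j, 0 ≤ w j)
include H hw

theorem sum_pairs_le : ∑ j, ∑ l ∈ A j, κ j * (w j + w l) ≤ 2 * ∑ j, κ j ^ 2 * w j := by
  have h0 : ∀ j, 0 ≤ κ j * w j := fun j => mul_nonneg (H.kappa_nonneg j) (hw j)
  have h1 := sum_relation_left_le H.card_le h0
  have h2 := sum_relation_right_le H.card_inv_le h0
  have e : ∑ j, ∑ l ∈ A j, κ j * (w j + w l)
      = ∑ j, ∑ _l ∈ A j, κ j * w j + ∑ j, ∑ l ∈ A j, κ l * w l := by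
    simp only [← Finset.sum_add_distrib]
    exact Finset.sum_congr rfl fun j _ => Finset.sum_congr rfl fun l hl => by
      rw [H.kappa_eq j l hl]; ring
  have e2 : ∑ j, κ j * (κ j * w j) = ∑ j, κ j ^ 2 * w j :=
    Finset.sum_congr rfl fun _ _ => by ring
  rw [e]
  linarith

theorem sum_triples_pair_le :
    ∑ j, ∑ l ∈ A j, ∑ _m ∈ A₂ j l, (w j + w l) ≤ 2 * ∑ j, κ j ^ 2 * w j := by
  refine le_trans ?_ (H.sum_pairs_le hw)
  refine Finset.sum_le_sum fun j _ => Finset.sum_le_sum fun l hl => ?_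
  rw [Finset.sum_const, nsmul_eq_mul]
  exact mul_le_mul_of_nonneg_right (H.card_second_le j l hl) (add_nonneg (hw j) (hw l))

/-- Double counting: `τ m` bounds the number of pairs whose second-order neighbourhood contains `m`.
-/
theorem sum_triples_third_le :
    ∑ j, ∑ l ∈ A j, ∑ m ∈ A₂ j l, w m ≤ ∑ j, τ j * w j := by
  have e : ∑ j, ∑ l ∈ A j, ∑ m ∈ A₂ j l, w m
      = ∑ t ∈ Finset.univ.sigma A, ∑ m ∈ A₂ t.1 t.2, w m := by
    rw [Finset.sum_sigma]
  rw [e, Finset.sum_comm' (t' := Finset.univ)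
    (s' := fun m => (Finset.univ.sigma A).filter fun t => m ∈ A₂ t.1 t.2) (by simp)]
  refine Finset.sum_le_sum fun m _ => ?_
  rw [Finset.sum_const, nsmul_eq_mul]
  refine mul_le_mul_of_nonneg_right (le_trans ?_ (H.card_pairs_le m)) (hw m)
  rw [Nat.cast_le]
  refine Finset.card_le_card_of_injOn (fun t => (t.1, t.2)) (fun t ht => ?_) ?_
  · simpa using ht
  · rintro ⟨a, b⟩ _ ⟨c, d⟩ _ hcd
    simp only [Prod.mk.injEq] at hcd
    obtain ⟨rfl, rfl⟩ := hcd
    rfl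

theorem sum_triples_le :
    ∑ j, ∑ l ∈ A j, ∑ m ∈ A₂ j l, κ j * (w j + w l + w m)
      ≤ 2 * ∑ j, (κ j ^ 3 + κ j * τ j) * w j := by
  have h0 : ∀ j, 0 ≤ κ j * w j := fun j => mul_nonneg (H.kappa_nonneg j) (hw j)
  have h1 := H.sum_triples_pair_le h0
  have h2 := H.sum_triples_third_le h0
  have e : ∑ j, ∑ l ∈ A j, ∑ m ∈ A₂ j l, κ j * (w j + w l + w m)
      = ∑ j, ∑ l ∈ A j, ∑ _m ∈ A₂ j l, (κ j * w j + κ l * w l)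
        + ∑ j, ∑ l ∈ A j, ∑ m ∈ A₂ j l, κ m * w m := by
    simp only [← Finset.sum_add_distrib]
    refine Finset.sum_congr rfl fun j _ => Finset.sum_congr rfl fun l hl =>
      Finset.sum_congr rfl fun m hm => ?_
    rw [H.kappa_eq j l hl, H.kappa_second_eq j l hl m hm]
    ring
  have e2 : 2 * ∑ j, (κ j ^ 3 + κ j * τ j) * w j
      = 2 * ∑ j, κ j ^ 2 * (κ j * w j) + ∑ j, τ j * (κ j * w j) + ∑ j, τ j * (κ j * w j) := by
    simp only [Finset.mul_sum, ← Finset.sum_add_distrib]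
    exact Finset.sum_congr rfl fun _ _ => by ring
  have h3 : 0 ≤ ∑ j, τ j * (κ j * w j) :=
    Finset.sum_nonneg fun j _ => mul_nonneg (H.tau_nonneg j) (h0 j)
  rw [e, e2]
  linarith

/-- `B` is left general because it is applied both to the neighbourhoods and to the reversed
relation. The last weight costs `τ` for the pairs reaching `p`, then `κ` for the `p` reaching `q`;
constancy of `τ` along `B` lets these multiply. -/
theorem sum_quadruples_le {B : ι → Finset ι} (hB : ∀ j, ((B j).card : ℝ) ≤ κ j)
    (hB' : ∀ j, ((Finset.univ.filter fun q => j ∈ B q).card : ℝ) ≤ κ j)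
    (hτ : ∀ p, ∀ q ∈ B p, τ q = τ p) :
    ∑ j, ∑ l ∈ A j, ∑ p ∈ A₂ j l, ∑ q ∈ B p, (w j + w l + w p + w q)
      ≤ 2 * ∑ j, (κ j ^ 3 + κ j * τ j) * w j := by
  have h0 : ∀ j, 0 ≤ κ j * w j := fun j => mul_nonneg (H.kappa_nonneg j) (hw j)
  have h1 := H.sum_triples_pair_le h0
  have h2 := H.sum_triples_third_le h0
  have h3 := H.sum_triples_third_le (w := fun p => ∑ q ∈ B p, w q)
    (fun p => Finset.sum_nonneg fun q _ => hw q)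
  have h4 : ∑ p, τ p * ∑ q ∈ B p, w q ≤ ∑ j, κ j * (τ j * w j) := by
    have := sum_relation_right_le hB' (w := fun j => τ j * w j)
      (fun j => mul_nonneg (H.tau_nonneg j) (hw j))
    refine le_trans (le_of_eq ?_) this
    refine Finset.sum_congr rfl fun p _ => ?_
    rw [Finset.mul_sum]
    exact Finset.sum_congr rfl fun q hq => by rw [hτ p q hq]
  have hle : ∑ j, ∑ l ∈ A j, ∑ p ∈ A₂ j l, ∑ q ∈ B p, (w j + w l + w p + w q)
      ≤ ∑ j, ∑ l ∈ A j, ∑ _p ∈ A₂ j l, (κ j * w j + κ l * w l)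
        + ∑ j, ∑ l ∈ A j, ∑ p ∈ A₂ j l, κ p * w p
        + ∑ j, ∑ l ∈ A j, ∑ p ∈ A₂ j l, ∑ q ∈ B p, w q := by
    simp only [← Finset.sum_add_distrib]
    refine Finset.sum_le_sum fun j _ => Finset.sum_le_sum fun l hl =>
      Finset.sum_le_sum fun p hp => ?_
    rw [Finset.sum_add_distrib, Finset.sum_const, nsmul_eq_mul, H.kappa_eq j l hl,
      H.kappa_second_eq j l hl p hp]
    have := mul_le_mul_of_nonneg_right (hB p) (add_nonneg (add_nonneg (hw j) (hw l)) (hw p))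
    rw [H.kappa_second_eq j l hl p hp] at this
    linarith
  have e2 : 2 * ∑ j, (κ j ^ 3 + κ j * τ j) * w j
      = 2 * ∑ j, κ j ^ 2 * (κ j * w j) + ∑ j, τ j * (κ j * w j) + ∑ j, κ j * (τ j * w j) := by
    simp only [Finset.mul_sum, ← Finset.sum_add_distrib]
    exact Finset.sum_congr rfl fun _ _ => by ring
  rw [e2]
  linarith

end Counting

/-! ### Variances of sums of functions of neighbouring pairs. -/

section Moments

variable (H : LocallyDependent μ ξ A A₂ κ τ)

/-- A variable dominating the whole family. -/
def dominating (ξ : ι → Ω → ℝ) (ω : Ω) : ℝ := ∑ j, |ξ j ω|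

include H

theorem memLp_dominating : MemLp (dominating ξ) 4 μ :=
  memLp_finsetSum Finset.univ fun j _ => (H.memLp j).abs

theorem polyGrowth (j : ι) : PolyGrowth (dominating ξ) 1 (ξ j) := by
  refine ⟨H.measurable j, 1, zero_le_one, fun ω => ?_⟩
  have h := Finset.single_le_sum (f := fun j => |ξ j ω|) (fun _ _ => abs_nonneg _)
    (Finset.mem_univ j)
  have : |dominating ξ ω| = dominating ξ ω :=
    abs_of_nonneg (Finset.sum_nonneg fun _ _ => abs_nonneg _)
  rw [this, dominating, pow_one, one_mul]
  linarith

theorem polyGrowth_nbhdSum (s : Finset ι) : PolyGrowth (dominating ξ) 1 (nbhdSum ξ s) :=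
  PolyGrowth.sum s fun j _ => H.polyGrowth j

variable [IsProbabilityMeasure μ]

/-- Nonnegativity of the variance of the difference bounds a covariance by half the sum of the
variances; each of these is at most a second moment of a product. -/
theorem covariance_pairs_le {g g' : ℝ × ℝ → ℝ} (hg : Measurable g) (hg' : Measurable g') {c : ℝ}
    (hb : ∀ t, |g t| ≤ c * |t.1 * t.2|) (hb' : ∀ t, |g' t| ≤ c * |t.1 * t.2|) (j l p q : ι) :
    cov[fun ω => g (ξ j ω, ξ l ω), fun ω => g' (ξ p ω, ξ q ω); μ]
      ≤ c ^ 2 / 4 * ((∫ ω, ξ j ω ^ 4 ∂μ) + (∫ ω, ξ l ω ^ 4 ∂μ) + (∫ ω, ξ p ω ^ 4 ∂μ)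
        + ∫ ω, ξ q ω ^ 4 ∂μ) := by
  have hQ := H.memLp_dominating
  have key : ∀ {g : ℝ × ℝ → ℝ} (_ : Measurable g) (_ : ∀ t, |g t| ≤ c * |t.1 * t.2|) (j l : ι),
      MemLp (fun ω => g (ξ j ω, ξ l ω)) 2 μ ∧
      Var[fun ω => g (ξ j ω, ξ l ω); μ]
        ≤ c ^ 2 / 2 * ((∫ ω, ξ j ω ^ 4 ∂μ) + ∫ ω, ξ l ω ^ 4 ∂μ) := by
    intro g hg hb j l
    have hm : Measurable fun ω => g (ξ j ω, ξ l ω) :=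
      hg.comp ((H.measurable j).prodMk (H.measurable l))
    have hp : PolyGrowth (dominating ξ) 2 fun ω => g (ξ j ω, ξ l ω) :=
      PolyGrowth.of_le hm ((((H.polyGrowth j).mul (H.polyGrowth l)).abs).const_mul c) fun ω =>
        (hb _).trans (le_abs_self _)
    refine ⟨hp.memLp_two hQ le_rfl, (variance_le_expectation_sq hm.aestronglyMeasurable).trans ?_⟩
    have i1 := ((H.polyGrowth j).pow 4).integrable hQ le_rfl
    have i2 := ((H.polyGrowth l).pow 4).integrable hQ le_rfl
    rw [← integral_add i1 i2, ← integral_const_mul]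
    refine integral_mono ((hp.pow 2).integrable hQ le_rfl) ((i1.add i2).const_mul _) fun ω => ?_
    have h1 := hb (ξ j ω, ξ l ω)
    simp only [Pi.pow_apply] at h1 ⊢
    have h2 : g (ξ j ω, ξ l ω) ^ 2 ≤ (c * |ξ j ω * ξ l ω|) ^ 2 := by
      rw [← sq_abs]
      exact pow_le_pow_left₀ (abs_nonneg _) h1 2
    rw [mul_pow, sq_abs] at h2
    have h3 : (ξ j ω * ξ l ω) ^ 2 ≤ (ξ j ω ^ 4 + ξ l ω ^ 4) / 2 := by
      nlinarith [sq_nonneg (ξ j ω ^ 2 - ξ l ω ^ 2)]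
    nlinarith [mul_le_mul_of_nonneg_left h3 (sq_nonneg c)]
  obtain ⟨m1, v1⟩ := key hg hb j l
  obtain ⟨m2, v2⟩ := key hg' hb' p q
  have h := variance_nonneg ((fun ω => g (ξ j ω, ξ l ω)) - fun ω => g' (ξ p ω, ξ q ω)) μ
  rw [variance_sub m1 m2] at h
  linarith

/-- Only quadruples with `p` or `q` in `A₂ j l` contribute. The two cases are counted separately,
the second by reversing the relation between `p` and `q`. -/
theorem variance_sum_pairs_le {G : ι → ι → ℝ × ℝ → ℝ} (hG : ∀ j l, Measurable (G j l)) {c : ℝ}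
    (hb : ∀ j, ∀ l ∈ A j, ∀ t, |G j l t| ≤ c * |t.1 * t.2|) :
    Var[fun ω => ∑ j, ∑ l ∈ A j, G j l (ξ j ω, ξ l ω); μ]
      ≤ c ^ 2 * ∑ j, (κ j ^ 3 + κ j * τ j) * ∫ ω, ξ j ω ^ 4 ∂μ := by
  set w : ι → ℝ := fun j => ∫ ω, ξ j ω ^ 4 ∂μ with hwdef
  have hw : ∀ j, 0 ≤ w j := fun j => integral_nonneg fun ω => by positivity
  have hQ := H.memLp_dominating
  have hmem : ∀ t ∈ Finset.univ.sigma A,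
      MemLp (fun ω => G t.1 t.2 (ξ t.1 ω, ξ t.2 ω)) 2 μ := by
    intro t ht
    have ht : t.2 ∈ A t.1 := by simpa using ht
    exact (PolyGrowth.of_le ((hG _ _).comp ((H.measurable _).prodMk (H.measurable _)))
      ((((H.polyGrowth t.1).mul (H.polyGrowth t.2)).abs).const_mul c) fun ω =>
        (hb _ _ ht _).trans (le_abs_self _)).memLp_two hQ le_rfl
  have e1 : (fun ω => ∑ j, ∑ l ∈ A j, G j l (ξ j ω, ξ l ω))
      = fun ω => ∑ t ∈ Finset.univ.sigma A, G t.1 t.2 (ξ t.1 ω, ξ t.2 ω) := by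
    funext ω
    rw [Finset.sum_sigma]
  rw [e1, variance_fun_sum' hmem]
  set E : ι → ι → ι → ι → ℝ := fun j l p q => c ^ 2 / 4 * (w j + w l + w p + w q) with hE
  have hE0 : ∀ j l p q, 0 ≤ E j l p q := fun j l p q => by
    have := hw j; have := hw l; have := hw p; have := hw q
    simp only [hE]; positivity
  have hcov : ∀ j, ∀ l ∈ A j, ∀ p, ∀ q ∈ A p,
      cov[fun ω => G j l (ξ j ω, ξ l ω), fun ω => G p q (ξ p ω, ξ q ω); μ]
        ≤ (if p ∈ A₂ j l then E j l p q else 0) + (if q ∈ A₂ j l then E j l q p else 0) := by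
    intro j l hl p q hq
    have hle := H.covariance_pairs_le (hG j l) (hG p q) (hb j l hl) (hb p q hq) j l p q
    have hsym : E j l q p = E j l p q := by simp only [hE]; ring
    by_cases hp : p ∈ A₂ j l
    · rw [if_pos hp]
      have : 0 ≤ if q ∈ A₂ j l then E j l q p else 0 := by split_ifs; exacts [hE0 _ _ _ _, le_rfl]
      exact hle.trans (le_add_of_nonneg_right this)
    · rw [if_neg hp, zero_add]
      by_cases hq2 : q ∈ A₂ j l
      · rw [if_pos hq2, hsym]
        exact hle
      · rw [if_neg hq2]
        have hind := (H.indep_pair_pair j l hl p hp q hq2).comp (hG j l) (hG p q)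
        exact (hind.covariance_eq_zero (hmem ⟨j, l⟩ (by simpa using hl))
          (hmem ⟨p, q⟩ (by simpa using hq))).le
  have hsum : ∀ j, ∀ l ∈ A j,
      ∑ p, ∑ q ∈ A p, cov[fun ω => G j l (ξ j ω, ξ l ω), fun ω => G p q (ξ p ω, ξ q ω); μ]
      ≤ ∑ p ∈ A₂ j l, ∑ q ∈ A p, E j l p q
        + ∑ q ∈ A₂ j l, ∑ p ∈ Finset.univ.filter (fun p => q ∈ A p), E j l q p := by
    intro j l hl
    refine (Finset.sum_le_sum fun p _ => Finset.sum_le_sum fun q hq =>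
      hcov j l hl p q hq).trans (le_of_eq ?_)
    simp only [Finset.sum_add_distrib]
    congr 1
    · rw [← Finset.sum_filter_add_sum_filter_not Finset.univ (fun p => p ∈ A₂ j l)]
      rw [Finset.sum_eq_zero (s := Finset.univ.filter fun p => p ∉ A₂ j l), add_zero]
      · rw [Finset.filter_mem_eq_inter, Finset.univ_inter]
        exact Finset.sum_congr rfl fun p hp => by simp only [if_pos hp]
      · intro p hp
        simp only [if_neg (Finset.mem_filter.1 hp).2, Finset.sum_const_zero]
    · rw [Finset.sum_comm' (t' := Finset.univ)
        (s' := fun q => Finset.univ.filter fun p => q ∈ A p) (by simp)]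
      rw [← Finset.sum_filter_add_sum_filter_not Finset.univ (fun p => p ∈ A₂ j l)]
      rw [Finset.sum_eq_zero (s := Finset.univ.filter fun p => p ∉ A₂ j l), add_zero]
      · rw [Finset.filter_mem_eq_inter, Finset.univ_inter]
        exact Finset.sum_congr rfl fun p hp => by simp only [if_pos hp]
      · intro p hp
        simp only [if_neg (Finset.mem_filter.1 hp).2, Finset.sum_const_zero]
  have q1 := H.sum_quadruples_le hw H.card_le H.card_inv_le H.tau_eq
  have q2 := H.sum_quadruples_le hw (B := fun q => Finset.univ.filter fun p => q ∈ A p)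
    H.card_inv_le (by simpa using H.card_le) (fun p q hq => by
      rw [H.tau_eq q p (by simpa using hq)])
  calc ∑ s ∈ Finset.univ.sigma A, ∑ t ∈ Finset.univ.sigma A,
        cov[fun ω => G s.1 s.2 (ξ s.1 ω, ξ s.2 ω), fun ω => G t.1 t.2 (ξ t.1 ω, ξ t.2 ω); μ]
      = ∑ j, ∑ l ∈ A j, ∑ p, ∑ q ∈ A p,
        cov[fun ω => G j l (ξ j ω, ξ l ω), fun ω => G p q (ξ p ω, ξ q ω); μ] := by
        simp only [Finset.sum_sigma]
    _ ≤ ∑ j, ∑ l ∈ A j, (∑ p ∈ A₂ j l, ∑ q ∈ A p, E j l p q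
        + ∑ q ∈ A₂ j l, ∑ p ∈ Finset.univ.filter (fun p => q ∈ A p), E j l q p) :=
        Finset.sum_le_sum fun j _ => Finset.sum_le_sum fun l hl => hsum j l hl
    _ ≤ _ := by
        simp only [Finset.sum_add_distrib, hE, ← Finset.mul_sum] at q1 q2 ⊢
        nlinarith [mul_le_mul_of_nonneg_left q1 (sq_nonneg c),
          mul_le_mul_of_nonneg_left q2 (sq_nonneg c)]

end Moments
end LocallyDependent

/-! ### Moment estimates -/

theorem integral_abs_pow_eq_lpNorm_pow {Ω : Type*} [MeasurableSpace Ω] {μ : Measure Ω}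
    {f : Ω → ℝ} (hf : AEStronglyMeasurable f μ) {n : ℕ} (hn : n ≠ 0) :
    ∫ ω, |f ω| ^ n ∂μ = lpNorm f n μ ^ n := by
  have h := lpNorm_nnreal_eq_integral_norm_rpow (p := (n : NNReal)) (by exact_mod_cast hn) hf
  have e : ((n : NNReal) : ENNReal) = (n : ENNReal) := by simp
  rw [e] at h
  rw [h]
  simp only [NNReal.coe_natCast, Real.rpow_natCast, Real.norm_eq_abs]
  rw [Real.rpow_inv_natCast_pow (integral_nonneg fun ω => by positivity) hn]

theorem integral_abs_pow_le_lpNorm_four_pow {Ω : Type*} [MeasurableSpace Ω] {μ : Measure Ω}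
    [IsProbabilityMeasure μ] {f : Ω → ℝ} (hf : MemLp f 4 μ) {n : ℕ} (hn : n ≠ 0) (hn4 : n ≤ 4) :
    ∫ ω, |f ω| ^ n ∂μ ≤ lpNorm f 4 μ ^ n := by
  rw [integral_abs_pow_eq_lpNorm_pow hf.1 hn]
  refine pow_le_pow_left₀ lpNorm_nonneg ?_ n
  rw [← toReal_eLpNorm hf.1, ← toReal_eLpNorm hf.1]
  exact ENNReal.toReal_mono hf.2.ne
    (eLpNorm_le_eLpNorm_of_exponent_le (by exact_mod_cast hn4) hf.1)

theorem mul_sq_le_cube_add_cube {x y : ℝ} (hx : 0 ≤ x) (hy : 0 ≤ y) :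
    x * y ^ 2 ≤ x ^ 3 + y ^ 3 := by
  rcases le_total x y with h | h
  · nlinarith [mul_le_mul_of_nonneg_right h (sq_nonneg y), pow_nonneg hx 3]
  · nlinarith [mul_le_mul_of_nonneg_left (pow_le_pow_left₀ hy h 2) hx, pow_nonneg hy 3]

theorem cube_mul_le_pow_four_add {x y : ℝ} (hx : 0 ≤ x) (hy : 0 ≤ y) :
    x ^ 3 * y ≤ x ^ 4 + y ^ 4 := by
  rcases le_total x y with h | h
  · nlinarith [mul_le_mul_of_nonneg_right (pow_le_pow_left₀ hx h 3) hy, pow_nonneg hx 4]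
  · nlinarith [mul_le_mul_of_nonneg_left h (pow_nonneg hx 3), pow_nonneg hy 4]

theorem mul_sq_mul_le_pow_four {x y z : ℝ} (hx : 0 ≤ x) (hy : 0 ≤ y) (hz : 0 ≤ z) :
    x * y ^ 2 * z ≤ x ^ 4 + y ^ 4 + z ^ 4 := by
  nlinarith [mul_nonneg hx hz, sq_nonneg (x * z - y ^ 2), sq_nonneg (x ^ 2 - z ^ 2),
    pow_nonneg hx 4, pow_nonneg hz 4, pow_nonneg hy 4]

namespace LocallyDependent

variable {ι Ω : Type*} [Fintype ι] [DecidableEq ι] [MeasurableSpace Ω]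
  {μ : Measure Ω} {ξ : ι → Ω → ℝ} {A : ι → Finset ι} {A₂ : ι → ι → Finset ι} {κ τ : ι → ℝ}
  (H : LocallyDependent μ ξ A A₂ κ τ)
include H

theorem integral_pow_four_eq (j : ι) : ∫ ω, ξ j ω ^ 4 ∂μ = lpNorm (ξ j) 4 μ ^ 4 := by
  have h := integral_abs_pow_eq_lpNorm_pow (H.memLp j).1 (n := 4) (by norm_num)
  rw [Nat.cast_ofNat] at h
  rw [← h]
  refine integral_congr_ae (Filter.Eventually.of_forall fun ω => ?_)
  simp only
  rw [Even.pow_abs (by decide)]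

theorem polyGrowth_mul_sq (j l : ι) :
    PolyGrowth (dominating ξ) 3 fun ω => |ξ j ω| * ξ l ω ^ 2 :=
  (H.polyGrowth j).abs.mul ((H.polyGrowth l).pow 2)

theorem sq_nbhdSum_le (j : ι) (ω : Ω) :
    nbhdSum ξ (A j) ω ^ 2 ≤ ∑ l ∈ A j, κ j * ξ l ω ^ 2 := by
  rw [← Finset.mul_sum]
  exact (sq_sum_le_card_mul_sum_sq (s := A j) (f := fun l => ξ l ω)).trans
    (mul_le_mul_of_nonneg_right (H.card_le j) (Finset.sum_nonneg fun _ _ => sq_nonneg _))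

variable [IsProbabilityMeasure μ]

theorem integral_abs_mul_sq_le (j l : ι) :
    ∫ ω, |ξ j ω| * ξ l ω ^ 2 ∂μ ≤ lpNorm (ξ j) 4 μ ^ 3 + lpNorm (ξ l) 4 μ ^ 3 := by
  have hQ := H.memLp_dominating
  have i1 := ((H.polyGrowth j).abs.pow 3).integrable hQ (by norm_num)
  have i2 := ((H.polyGrowth l).abs.pow 3).integrable hQ (by norm_num)
  calc ∫ ω, |ξ j ω| * ξ l ω ^ 2 ∂μ ≤ ∫ ω, |ξ j ω| ^ 3 + |ξ l ω| ^ 3 ∂μ := by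
        refine integral_mono ((H.polyGrowth_mul_sq j l).integrable hQ (by norm_num)) (i1.add i2)
          fun ω => ?_
        have := mul_sq_le_cube_add_cube (abs_nonneg (ξ j ω)) (abs_nonneg (ξ l ω))
        rwa [sq_abs] at this
    _ ≤ _ := by
        rw [integral_add i1 i2]
        exact add_le_add
          (integral_abs_pow_le_lpNorm_four_pow (H.memLp j) (by norm_num) (by norm_num))
          (integral_abs_pow_le_lpNorm_four_pow (H.memLp l) (by norm_num) (by norm_num))

theorem sum_integral_abs_mul_sq_le :
    ∑ j, ∑ l ∈ A j, κ j * ∫ ω, |ξ j ω| * ξ l ω ^ 2 ∂μ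
      ≤ 2 * ∑ j, κ j ^ 2 * lpNorm (ξ j) 4 μ ^ 3 :=
  (Finset.sum_le_sum fun j _ => Finset.sum_le_sum fun l _ =>
    mul_le_mul_of_nonneg_left (H.integral_abs_mul_sq_le j l) (H.kappa_nonneg j)).trans
    (H.sum_pairs_le fun _ => pow_nonneg lpNorm_nonneg 3)

theorem sum_integral_abs_mul_sq_nbhdSum_le :
    ∑ j, ∫ ω, |ξ j ω| * nbhdSum ξ (A j) ω ^ 2 ∂μ
      ≤ 2 * ∑ j, κ j ^ 2 * lpNorm (ξ j) 4 μ ^ 3 := by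
  have hQ := H.memLp_dominating
  refine le_trans (Finset.sum_le_sum fun j _ => ?_) H.sum_integral_abs_mul_sq_le
  have hint : ∀ l ∈ A j, Integrable (fun ω => κ j * (|ξ j ω| * ξ l ω ^ 2)) μ := fun l _ =>
    ((H.polyGrowth_mul_sq j l).integrable hQ (by norm_num)).const_mul _
  simp only [← integral_const_mul]
  rw [← integral_finsetSum _ hint]
  refine integral_mono
    (((H.polyGrowth j).abs.mul ((H.polyGrowth_nbhdSum (A j)).pow 2)).integrable hQ (by norm_num))
    (integrable_finsetSum _ hint) fun ω => ?_
  refine (mul_le_mul_of_nonneg_left (H.sq_nbhdSum_le j ω) (abs_nonneg _)).trans (le_of_eq ?_)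
  rw [Finset.mul_sum]
  exact Finset.sum_congr rfl fun _ _ => by ring

/-- Outside `A₂ j l` the rest `R` of the sum is independent of the pair, so its expectation factors
out, and `E|R| ≤ E|W| + ∑ a m` with `E|W| ≤ 1`. The terms inside `A₂ j l` are bounded by fourth
moments. -/
theorem integral_abs_mul_sq_mul_abs_sum_le
    (hW : ∫ ω, nbhdSum ξ Finset.univ ω ^ 2 ∂μ = 1) {j l : ι} (hl : l ∈ A j) :
    ∫ ω, |ξ j ω| * ξ l ω ^ 2 * |nbhdSum ξ Finset.univ ω| ∂μ
      ≤ (lpNorm (ξ j) 4 μ ^ 3 + lpNorm (ξ l) 4 μ ^ 3)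
        + ∑ m ∈ A₂ j l,
          3 * (lpNorm (ξ j) 4 μ ^ 4 + lpNorm (ξ l) 4 μ ^ 4 + lpNorm (ξ m) 4 μ ^ 4) := by
  have hQ := H.memLp_dominating
  set a : ι → ℝ := fun j => lpNorm (ξ j) 4 μ with ha
  have ha0 : ∀ j, 0 ≤ a j := fun j => lpNorm_nonneg
  set R := nbhdSum ξ (A₂ j l)ᶜ with hR
  have habs : ∀ m, ∫ ω, |ξ m ω| ∂μ ≤ a m := fun m => by
    have := integral_abs_pow_le_lpNorm_four_pow (H.memLp m) (n := 1) (by norm_num) (by norm_num)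
    simpa using this
  have hsplit : ∀ ω, nbhdSum ξ Finset.univ ω = R ω + ∑ m ∈ A₂ j l, ξ m ω := fun ω =>
    (Finset.sum_compl_add_sum (A₂ j l) fun m => ξ m ω).symm
  have im : ∀ m, Integrable (fun ω => |ξ m ω|) μ := fun m =>
    (H.polyGrowth m).abs.integrable hQ (by norm_num)
  have iR : Integrable (fun ω => |R ω|) μ :=
    (H.polyGrowth_nbhdSum _).abs.integrable hQ (by norm_num)
  have iW : Integrable (fun ω => nbhdSum ξ Finset.univ ω ^ 2) μ :=
    ((H.polyGrowth_nbhdSum _).pow 2).integrable hQ (by norm_num)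
  have i3 : Integrable (fun ω => |ξ j ω| * ξ l ω ^ 2) μ :=
    (H.polyGrowth_mul_sq j l).integrable hQ (by norm_num)
  have hER : ∫ ω, |R ω| ∂μ ≤ 1 + ∑ m ∈ A₂ j l, a m := by
    have i0 : Integrable (fun ω => (1 + nbhdSum ξ Finset.univ ω ^ 2) / 2) μ :=
      ((integrable_const (1 : ℝ)).add iW).div_const 2
    have is : Integrable (fun ω => ∑ m ∈ A₂ j l, |ξ m ω|) μ :=
      integrable_finsetSum _ fun m _ => im m
    calc ∫ ω, |R ω| ∂μ
        ≤ ∫ ω, (1 + nbhdSum ξ Finset.univ ω ^ 2) / 2 + ∑ m ∈ A₂ j l, |ξ m ω| ∂μ := by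
          refine integral_mono iR (i0.add is) fun ω => ?_
          have e : R ω = nbhdSum ξ Finset.univ ω - ∑ m ∈ A₂ j l, ξ m ω := by rw [hsplit]; ring
          have h1 := abs_sub (nbhdSum ξ Finset.univ ω) (∑ m ∈ A₂ j l, ξ m ω)
          have h2 := Finset.abs_sum_le_sum_abs (fun m => ξ m ω) (A₂ j l)
          have h3 : |nbhdSum ξ Finset.univ ω| ≤ (1 + nbhdSum ξ Finset.univ ω ^ 2) / 2 := by
            nlinarith [sq_nonneg (|nbhdSum ξ Finset.univ ω| - 1),
              sq_abs (nbhdSum ξ Finset.univ ω)]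
          simp only
          rw [e]
          linarith
      _ ≤ 1 + ∑ m ∈ A₂ j l, a m := by
          rw [integral_add i0 is, integral_div, integral_add (integrable_const _) iW, hW,
            integral_finsetSum _ fun m _ => im m]
          have := Finset.sum_le_sum fun m (_ : m ∈ A₂ j l) => habs m
          simp only [integral_const, probReal_univ, smul_eq_mul, mul_one]
          linarith
  have hprod : ∫ ω, |ξ j ω| * ξ l ω ^ 2 * |R ω| ∂μ
      = (∫ ω, |ξ j ω| * ξ l ω ^ 2 ∂μ) * ∫ ω, |R ω| ∂μ := by
    have hind := (H.indep_pair_compl j l hl).comp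
      (φ := fun t : ℝ × ℝ => |t.1| * t.2 ^ 2) (ψ := fun x : ℝ => |x|)
      (by fun_prop) (by fun_prop)
    exact hind.integral_fun_mul_eq_mul_integral i3.aestronglyMeasurable iR.aestronglyMeasurable
  have i4 : ∀ m, Integrable (fun ω => ξ m ω ^ 4) μ := fun m =>
    ((H.polyGrowth m).pow 4).integrable hQ le_rfl
  have i3m : ∀ m, Integrable (fun ω => |ξ j ω| * ξ l ω ^ 2 * |ξ m ω|) μ := fun m =>
    ((H.polyGrowth_mul_sq j l).mul (H.polyGrowth m).abs).integrable hQ le_rfl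
  have h4 : ∀ m, ∫ ω, |ξ j ω| * ξ l ω ^ 2 * |ξ m ω| ∂μ ≤ a j ^ 4 + a l ^ 4 + a m ^ 4 := by
    intro m
    have i4jl : Integrable (fun ω => ξ j ω ^ 4 + ξ l ω ^ 4) μ := (i4 j).add (i4 l)
    rw [ha]
    simp only
    rw [← H.integral_pow_four_eq j, ← H.integral_pow_four_eq l, ← H.integral_pow_four_eq m,
      ← integral_add (i4 j) (i4 l), ← integral_add i4jl (i4 m)]
    refine integral_mono (i3m m) (i4jl.add (i4 m)) fun ω => ?_
    have := mul_sq_mul_le_pow_four (abs_nonneg (ξ j ω)) (abs_nonneg (ξ l ω)) (abs_nonneg (ξ m ω))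
    rw [sq_abs, Even.pow_abs (by decide), Even.pow_abs (by decide), Even.pow_abs (by decide)]
      at this
    exact this
  have i3R : Integrable (fun ω => |ξ j ω| * ξ l ω ^ 2 * |R ω|) μ :=
    ((H.polyGrowth_mul_sq j l).mul (H.polyGrowth_nbhdSum _).abs).integrable hQ le_rfl
  have i3W : Integrable (fun ω => |ξ j ω| * ξ l ω ^ 2 * |nbhdSum ξ Finset.univ ω|) μ :=
    ((H.polyGrowth_mul_sq j l).mul (H.polyGrowth_nbhdSum _).abs).integrable hQ le_rfl
  have is3 : Integrable (fun ω => ∑ m ∈ A₂ j l, |ξ j ω| * ξ l ω ^ 2 * |ξ m ω|) μ :=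
    integrable_finsetSum _ fun m _ => i3m m
  have h30 : 0 ≤ ∫ ω, |ξ j ω| * ξ l ω ^ 2 ∂μ := integral_nonneg fun ω => by positivity
  calc ∫ ω, |ξ j ω| * ξ l ω ^ 2 * |nbhdSum ξ Finset.univ ω| ∂μ
      ≤ ∫ ω, |ξ j ω| * ξ l ω ^ 2 * |R ω| + ∑ m ∈ A₂ j l, |ξ j ω| * ξ l ω ^ 2 * |ξ m ω| ∂μ := by
        refine integral_mono i3W (i3R.add is3) fun ω => ?_
        simp only
        rw [← Finset.mul_sum, ← mul_add, hsplit]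
        refine mul_le_mul_of_nonneg_left ((abs_add_le _ _).trans ?_) (by positivity)
        have h2 := Finset.abs_sum_le_sum_abs (fun m => ξ m ω) (A₂ j l)
        linarith
    _ = (∫ ω, |ξ j ω| * ξ l ω ^ 2 ∂μ) * ∫ ω, |R ω| ∂μ
        + ∑ m ∈ A₂ j l, ∫ ω, |ξ j ω| * ξ l ω ^ 2 * |ξ m ω| ∂μ := by
        rw [integral_add i3R is3, hprod, integral_finsetSum _ fun m _ => i3m m]
    _ ≤ (a j ^ 3 + a l ^ 3) * (1 + ∑ m ∈ A₂ j l, a m)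
        + ∑ m ∈ A₂ j l, (a j ^ 4 + a l ^ 4 + a m ^ 4) := by
        refine add_le_add (mul_le_mul (H.integral_abs_mul_sq_le j l) hER
          (integral_nonneg fun ω => abs_nonneg _) ?_) (Finset.sum_le_sum fun m _ => h4 m)
        have := ha0 j; have := ha0 l
        positivity
    _ ≤ _ := by
        rw [mul_add, mul_one, add_assoc, Finset.mul_sum, ← Finset.sum_add_distrib]
        refine add_le_add le_rfl (Finset.sum_le_sum fun m _ => ?_)
        have h1 := cube_mul_le_pow_four_add (ha0 j) (ha0 m)
        have h2 := cube_mul_le_pow_four_add (ha0 l) (ha0 m)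
        have h3 := pow_nonneg (ha0 j) 4
        have h4 := pow_nonneg (ha0 l) 4
        linarith

theorem sum_integral_abs_mul_sq_nbhdSum_mul_abs_le
    (hW : ∫ ω, nbhdSum ξ Finset.univ ω ^ 2 ∂μ = 1) :
    ∑ j, ∫ ω, |ξ j ω| * nbhdSum ξ (A j) ω ^ 2 * |nbhdSum ξ Finset.univ ω| ∂μ
      ≤ 2 * ∑ j, κ j ^ 2 * lpNorm (ξ j) 4 μ ^ 3
        + 6 * ∑ j, (κ j ^ 3 + κ j * τ j) * lpNorm (ξ j) 4 μ ^ 4 := by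
  have hQ := H.memLp_dominating
  have h1 := H.sum_pairs_le (w := fun j => lpNorm (ξ j) 4 μ ^ 3)
    fun _ => pow_nonneg lpNorm_nonneg 3
  have h2 := H.sum_triples_le (w := fun j => lpNorm (ξ j) 4 μ ^ 4)
    fun _ => pow_nonneg lpNorm_nonneg 4
  have hj : ∀ j, ∫ ω, |ξ j ω| * nbhdSum ξ (A j) ω ^ 2 * |nbhdSum ξ Finset.univ ω| ∂μ
      ≤ ∑ l ∈ A j, κ j * ∫ ω, |ξ j ω| * ξ l ω ^ 2 * |nbhdSum ξ Finset.univ ω| ∂μ := by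
    intro j
    have hint : ∀ l ∈ A j, Integrable
        (fun ω => κ j * (|ξ j ω| * ξ l ω ^ 2 * |nbhdSum ξ Finset.univ ω|)) μ := fun l _ =>
      (((H.polyGrowth_mul_sq j l).mul (H.polyGrowth_nbhdSum _).abs).integrable hQ
        le_rfl).const_mul _
    simp only [← integral_const_mul]
    rw [← integral_finsetSum _ hint]
    refine integral_mono ((((H.polyGrowth j).abs.mul ((H.polyGrowth_nbhdSum (A j)).pow 2)).mul
      (H.polyGrowth_nbhdSum _).abs).integrable hQ le_rfl) (integrable_finsetSum _ hint) fun ω => ?_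
    have := mul_le_mul_of_nonneg_right
      (mul_le_mul_of_nonneg_left (H.sq_nbhdSum_le j ω) (abs_nonneg (ξ j ω)))
      (abs_nonneg (nbhdSum ξ Finset.univ ω))
    refine this.trans (le_of_eq ?_)
    rw [Finset.mul_sum, Finset.sum_mul]
    exact Finset.sum_congr rfl fun _ _ => by ring
  have h3 : ∑ j, ∫ ω, |ξ j ω| * nbhdSum ξ (A j) ω ^ 2 * |nbhdSum ξ Finset.univ ω| ∂μ
      ≤ ∑ j, ∑ l ∈ A j, κ j * (lpNorm (ξ j) 4 μ ^ 3 + lpNorm (ξ l) 4 μ ^ 3)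
        + 3 * ∑ j, ∑ l ∈ A j, ∑ m ∈ A₂ j l,
          κ j * (lpNorm (ξ j) 4 μ ^ 4 + lpNorm (ξ l) 4 μ ^ 4 + lpNorm (ξ m) 4 μ ^ 4) := by
    refine (Finset.sum_le_sum fun j _ => hj j).trans ?_
    rw [Finset.mul_sum, ← Finset.sum_add_distrib]
    refine Finset.sum_le_sum fun j _ => ?_
    rw [Finset.mul_sum, ← Finset.sum_add_distrib]
    refine Finset.sum_le_sum fun l hl => ?_
    refine (mul_le_mul_of_nonneg_left (H.integral_abs_mul_sq_mul_abs_sum_le hW hl)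
      (H.kappa_nonneg j)).trans (le_of_eq ?_)
    simp only [mul_add, Finset.mul_sum]
    congr 1
    exact Finset.sum_congr rfl fun _ _ => by ring
  linarith

end LocallyDependent

/-! ### Distribution functions and smoothing -/

theorem cdf_gaussianReal_std_sub_le {a b : ℝ} (hab : a ≤ b) :
    cdf (gaussianReal 0 1) b - cdf (gaussianReal 0 1) a ≤ b - a := by
  have hint := integrable_gaussianPDFReal 0 1
  have e : ∀ x, cdf (gaussianReal 0 1) x = ∫ t in Set.Iic x, gaussianPDFReal 0 1 t := fun x => by
    rw [cdf_eq_real, Measure.real, gaussianReal_apply_eq_integral 0 one_ne_zero,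
      ENNReal.toReal_ofReal (integral_nonneg fun t => gaussianPDFReal_nonneg 0 1 t)]
  have hle : ∀ t, gaussianPDFReal 0 1 t ≤ 1 := fun t => by
    have h1 : 1 ≤ √(2 * Real.pi * ((1 : NNReal) : ℝ)) :=
      Real.one_le_sqrt.2 (by have := Real.pi_gt_three; simp; linarith)
    have h2 : Real.exp (-(t - 0) ^ 2 / (2 * ((1 : NNReal) : ℝ))) ≤ 1 :=
      Real.exp_le_one_iff.2 (by simp; nlinarith [sq_nonneg t])
    exact mul_le_one₀ (inv_le_one_of_one_le₀ h1) (Real.exp_pos _).le h2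
  rw [e, e, intervalIntegral.integral_Iic_sub_Iic hint.integrableOn hint.integrableOn]
  have := intervalIntegral.integral_mono_on hab hint.intervalIntegrable
    (intervalIntegrable_const (c := (1 : ℝ)) (μ := volume)) fun t _ => hle t
  simpa using this

theorem integrable_ramp {Ω : Type*} [MeasurableSpace Ω] {μ : Measure Ω} [IsProbabilityMeasure μ]
    {W : Ω → ℝ} (hW : Measurable W) (z α : ℝ) : Integrable (fun ω => ramp z α (W ω)) μ :=
  Integrable.of_bound ((continuous_ramp z α).measurable.comp hW).aestronglyMeasurable 1
    (Filter.Eventually.of_forall fun ω => by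
      rw [Real.norm_eq_abs, abs_of_nonneg (ramp_nonneg _ _ _)]; exact ramp_le_one _ _ _)

theorem measureReal_le_integral_ramp {Ω : Type*} [MeasurableSpace Ω] {μ : Measure Ω}
    [IsProbabilityMeasure μ] {W : Ω → ℝ} (hW : Measurable W) (z : ℝ) {α : ℝ} (hα : 0 < α) :
    μ.real {ω | W ω ≤ z} ≤ ∫ ω, ramp z α (W ω) ∂μ := by
  have hs : MeasurableSet {ω | W ω ≤ z} := measurableSet_le hW measurable_const
  rw [← integral_indicator_one hs]
  refine integral_mono ((integrable_const (1 : ℝ)).indicator hs) (integrable_ramp hW z α) fun ω => ?_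
  by_cases h : W ω ≤ z
  · rw [Set.indicator_of_mem (by exact h), ramp_of_le hα h]; rfl
  · rw [Set.indicator_of_notMem (by exact h)]; exact ramp_nonneg _ _ _

theorem integral_ramp_le_measureReal {Ω : Type*} [MeasurableSpace Ω] {μ : Measure Ω}
    [IsProbabilityMeasure μ] {W : Ω → ℝ} (hW : Measurable W) (z : ℝ) {α : ℝ} (hα : 0 < α) :
    ∫ ω, ramp z α (W ω) ∂μ ≤ μ.real {ω | W ω ≤ z + α} := by
  have hs : MeasurableSet {ω | W ω ≤ z + α} := measurableSet_le hW measurable_const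
  rw [← integral_indicator_one hs]
  refine integral_mono (integrable_ramp hW z α) ((integrable_const (1 : ℝ)).indicator hs) fun ω => ?_
  by_cases h : W ω ≤ z + α
  · rw [Set.indicator_of_mem (by exact h)]; exact ramp_le_one _ _ _
  · rw [Set.indicator_of_notMem (by exact h), ramp_of_ge hα (not_le.1 h).le]

/-- The half-line indicator lies between the ramps started at `z - α` and at `z`; moving the normal
distribution function by `α` costs at most `α`. -/
theorem abs_measureReal_sub_cdf_le_of_smooth {Ω : Type*} [MeasurableSpace Ω] {μ : Measure Ω}
    [IsProbabilityMeasure μ] {W : Ω → ℝ} (hW : Measurable W) {α ε : ℝ} (hα : 0 < α)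
    (h : ∀ z, |(∫ ω, ramp z α (W ω) ∂μ) - ∫ x, ramp z α x ∂(gaussianReal 0 1)| ≤ ε) (z : ℝ) :
    |μ.real {ω | W ω ≤ z} - cdf (gaussianReal 0 1) z| ≤ α + ε := by
  have e : ∀ x, (gaussianReal 0 1).real {y | id y ≤ x} = cdf (gaussianReal 0 1) x := fun x =>
    (cdf_eq_real _ x).symm
  have u1 := measureReal_le_integral_ramp (μ := μ) hW z hα
  have u2 := integral_ramp_le_measureReal (μ := gaussianReal 0 1) measurable_id z hα
  have u3 := cdf_gaussianReal_std_sub_le (show z ≤ z + α by linarith)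
  have u4 := abs_le.1 (h z)
  have l1 := integral_ramp_le_measureReal (μ := μ) hW (z - α) hα
  have l2 := measureReal_le_integral_ramp (μ := gaussianReal 0 1) measurable_id (z - α) hα
  have l3 := cdf_gaussianReal_std_sub_le (show z - α ≤ z by linarith)
  have l4 := abs_le.1 (h (z - α))
  rw [e] at u2 l2
  rw [sub_add_cancel] at l1
  simp only [id] at u2 l2
  exact abs_le.2 ⟨by linarith, by linarith⟩

theorem measureReal_abs_sub_le {Ω : Type*} [MeasurableSpace Ω] {μ : Measure Ω}
    [IsProbabilityMeasure μ] {W : Ω → ℝ} (hW : Measurable W) {δ : ℝ}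
    (hδ : ∀ z, |μ.real {ω | W ω ≤ z} - cdf (gaussianReal 0 1) z| ≤ δ) (z : ℝ) {s : ℝ}
    (hs : 0 < s) : μ.real {ω | |W ω - z| ≤ 2 * s} ≤ 5 * s + 2 * δ := by
  have h1 := abs_le.1 (hδ (z + 2 * s))
  -- The shift is `3 s` rather than `2 s` so that the half-open difference set contains the left
  -- endpoint.
  have h2 := abs_le.1 (hδ (z - 3 * s))
  have h3 := cdf_gaussianReal_std_sub_le (show z - 3 * s ≤ z + 2 * s by linarith)
  have hsub : {ω | W ω ≤ z - 3 * s} ⊆ {ω | W ω ≤ z + 2 * s} := fun ω hω => by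
    simp only [Set.mem_ofPred_eq] at hω ⊢; linarith
  have h4 := measureReal_sdiff (μ := μ) hsub (measurableSet_le hW measurable_const)
  have h5 : μ.real {ω | |W ω - z| ≤ 2 * s}
      ≤ μ.real ({ω | W ω ≤ z + 2 * s} \ {ω | W ω ≤ z - 3 * s}) := by
    refine measureReal_mono fun ω hω => ?_
    have := abs_le.1 (show |W ω - z| ≤ 2 * s from hω)
    refine ⟨?_, ?_⟩
    · simp only [Set.mem_ofPred_eq]; linarith
    · simp only [Set.mem_ofPred_eq, not_le]; linarith
  linarith

/-- Decoupling of an event and a square integrable variable, at the cost of the variance. -/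
theorem integral_indicator_mul_le {Ω : Type*} [MeasurableSpace Ω] {μ : Measure Ω}
    [IsProbabilityMeasure μ] {χ V : Ω → ℝ} (hχ : Integrable χ μ) (hV : MemLp V 2 μ)
    (hχV : Integrable (fun ω => χ ω * V ω) μ) (h01 : ∀ ω, χ ω = 0 ∨ χ ω = 1) {r : ℝ}
    (hr : 0 < r) :
    ∫ ω, χ ω * V ω ∂μ ≤ (∫ ω, χ ω ∂μ) * (∫ ω, V ω ∂μ)
      + (r * (∫ ω, χ ω ∂μ) + Var[V; μ] / r) / 2 := by
  set m := ∫ ω, V ω ∂μ with hm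
  have hVm : Integrable (fun ω => (V ω - m) ^ 2) μ :=
    (hV.sub (memLp_const m)).integrable_sq
  have hvar : Var[V; μ] = ∫ ω, (V ω - m) ^ 2 ∂μ := by
    rw [variance_eq_integral hV.1.aemeasurable]
  have i1 : Integrable (fun ω => χ ω * (m + r / 2)) μ := hχ.mul_const _
  have i2 : Integrable (fun ω => (V ω - m) ^ 2 / (2 * r)) μ := hVm.div_const _
  calc ∫ ω, χ ω * V ω ∂μ ≤ ∫ ω, χ ω * (m + r / 2) + (V ω - m) ^ 2 / (2 * r) ∂μ := by
        refine integral_mono hχV (i1.add i2) fun ω => ?_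
        simp only
        rcases h01 ω with h | h
        · rw [h, zero_mul, zero_mul, zero_add]
          positivity
        · rw [h, one_mul, one_mul]
          -- On the event this is `V - m ≤ r/2 + (V - m)²/(2r)`, with the square completed; off the
          -- event only a nonnegative term remains.
          have : (V ω - m) ^ 2 / (2 * r) - (V ω - m) + r / 2 = (V ω - m - r) ^ 2 / (2 * r) := by
            field_simp
            ring
          have h2 : 0 ≤ (V ω - m - r) ^ 2 / (2 * r) := by positivity
          linarith
    _ = _ := by
        rw [integral_add i1 i2, integral_mul_const, integral_div, hvar]
        field_simp
        ring

/-! ### The Berry–Esseen bound under local dependence -/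

namespace LocallyDependent

variable {ι Ω : Type*} [Fintype ι] [DecidableEq ι] [MeasurableSpace Ω]
  {μ : Measure Ω} {ξ : ι → Ω → ℝ} {A : ι → Finset ι} {A₂ : ι → ι → Finset ι} {κ τ : ι → ℝ}
  (H : LocallyDependent μ ξ A A₂ κ τ)

/-- The statistic through which the ladder function at level `k` enters the bound. -/
noncomputable def ladderSum (ξ : ι → Ω → ℝ) (A : ι → Finset ι) (κ : ι → ℝ) (α : ℝ) (k : ℕ) (ω : Ω) : ℝ :=
  ∑ j, ∑ l ∈ A j, |ξ j ω| * ((κ j)⁻¹ * ladder α k (κ j * |ξ l ω|))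

include H

theorem abs_ladder_term_le {α : ℝ} (hα : 0 < α) (k : ℕ) (j : ι) (x y : ℝ) :
    abs (|x| * ((κ j)⁻¹ * ladder α k (κ j * |y|))) ≤ 2 * |x * y| := by
  have hκ := H.kappa_nonneg j
  have hy : 0 ≤ κ j * |y| := mul_nonneg hκ (abs_nonneg y)
  rw [abs_of_nonneg (mul_nonneg (abs_nonneg x)
    (mul_nonneg (inv_nonneg.2 hκ) (ladder_nonneg hα k hy))), abs_mul]
  rcases hκ.eq_or_lt with h | h
  · rw [← h]
    simp only [inv_zero, zero_mul, mul_zero]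
    positivity
  · have h1 := mul_le_mul_of_nonneg_left (ladder_le hα k hy) (inv_nonneg.2 hκ)
    have h2 : (κ j)⁻¹ * (2 * (κ j * |y|)) = 2 * |y| := by field_simp
    rw [h2] at h1
    nlinarith [mul_le_mul_of_nonneg_left h1 (abs_nonneg x)]

theorem measurable_ladder_term (α : ℝ) (k : ℕ) (j l : ι) :
    Measurable fun ω => |ξ j ω| * ((κ j)⁻¹ * ladder α k (κ j * |ξ l ω|)) :=
  (H.measurable j).abs.mul
    (((measurable_ladder α k).comp ((H.measurable l).abs.const_mul _)).const_mul _)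

theorem polyGrowth_ladder_term {α : ℝ} (hα : 0 < α) (k : ℕ) (j l : ι) :
    PolyGrowth (dominating ξ) 2
      fun ω => |ξ j ω| * ((κ j)⁻¹ * ladder α k (κ j * |ξ l ω|)) :=
  PolyGrowth.of_le (H.measurable_ladder_term α k j l)
    ((((H.polyGrowth j).mul (H.polyGrowth l)).abs).const_mul 2) fun _ =>
      (H.abs_ladder_term_le hα k j _ _).trans (le_abs_self _)

theorem polyGrowth_ladderSum {α : ℝ} (hα : 0 < α) (k : ℕ) :
    PolyGrowth (dominating ξ) 2 (ladderSum ξ A κ α k) :=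
  PolyGrowth.sum _ fun j _ => PolyGrowth.sum _ fun l _ => H.polyGrowth_ladder_term hα k j l

theorem sum_abs_mul_ladder_nbhdSum_le {α : ℝ} (hα : 0 < α) (k : ℕ) (ω : Ω) :
    ∑ j, |ξ j ω| * ladder α k |nbhdSum ξ (A j) ω| ≤ ladderSum ξ A κ α k ω := by
  refine Finset.sum_le_sum fun j _ => ?_
  rw [← Finset.mul_sum]
  exact mul_le_mul_of_nonneg_left (ladder_abs_sum_le hα k (A j) (H.card_le j) fun l => ξ l ω)
    (abs_nonneg _)

variable [IsProbabilityMeasure μ]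

theorem variance_ladderSum_le {α : ℝ} (hα : 0 < α) (k : ℕ) :
    Var[ladderSum ξ A κ α k; μ]
      ≤ 4 * ∑ j, (κ j ^ 3 + κ j * τ j) * lpNorm (ξ j) 4 μ ^ 4 := by
  have h := H.variance_sum_pairs_le
    (G := fun j _ t => |t.1| * ((κ j)⁻¹ * ladder α k (κ j * |t.2|))) (c := 2)
    (fun j l => measurable_fst.abs.mul
      (((measurable_ladder α k).comp (measurable_snd.abs.const_mul _)).const_mul _))
    (fun j l _ t => H.abs_ladder_term_le hα k j t.1 t.2)
  simp only [H.integral_pow_four_eq] at h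
  norm_num at h
  exact h

theorem sum_scale_mul_integral_ladderSum_le {α : ℝ} (hα : 0 < α) (N : ℕ) :
    ∑ k ∈ Finset.range (N + 1), α * 4 ^ k * ∫ ω, ladderSum ξ A κ α k ω ∂μ
      ≤ 68 * ∑ j, κ j ^ 2 * lpNorm (ξ j) 4 μ ^ 3 := by
  have hQ := H.memLp_dominating
  have hint : ∀ k j l, Integrable
      (fun ω => |ξ j ω| * ((κ j)⁻¹ * ladder α k (κ j * |ξ l ω|))) μ := fun k j l =>
    (H.polyGrowth_ladder_term hα k j l).integrable hQ (by norm_num)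
  have e : ∀ k, ∫ ω, ladderSum ξ A κ α k ω ∂μ
      = ∑ j, ∑ l ∈ A j, ∫ ω, |ξ j ω| * ((κ j)⁻¹ * ladder α k (κ j * |ξ l ω|)) ∂μ := by
    intro k
    unfold ladderSum
    rw [integral_finsetSum _ fun j _ => integrable_finsetSum _ fun l _ => hint k j l]
    exact Finset.sum_congr rfl fun j _ => integral_finsetSum _ fun l _ => hint k j l
  have hpair : ∀ j, ∀ l ∈ A j, ∑ k ∈ Finset.range (N + 1),
      α * 4 ^ k * ∫ ω, |ξ j ω| * ((κ j)⁻¹ * ladder α k (κ j * |ξ l ω|)) ∂μ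
      ≤ 34 * (κ j * ∫ ω, |ξ j ω| * ξ l ω ^ 2 ∂μ) := by
    intro j l hl
    have hκ := H.kappa_pos hl
    simp only [← integral_const_mul]
    rw [← integral_finsetSum _ fun k _ => (hint k j l).const_mul _]
    refine integral_mono (integrable_finsetSum _ fun k _ => (hint k j l).const_mul _)
      ((((H.polyGrowth_mul_sq j l).integrable hQ (by norm_num)).const_mul _).const_mul _)
      fun ω => ?_
    have h := sum_scale_mul_ladder_le hα (mul_nonneg hκ.le (abs_nonneg (ξ l ω))) N
    have h2 := mul_le_mul_of_nonneg_left h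
      (mul_nonneg (abs_nonneg (ξ j ω)) (inv_nonneg.2 hκ.le))
    rw [Finset.mul_sum, mul_pow, sq_abs] at h2
    refine le_trans (le_of_eq ?_) (h2.trans (le_of_eq ?_))
    · exact Finset.sum_congr rfl fun k _ => by ring
    · field_simp
  calc ∑ k ∈ Finset.range (N + 1), α * 4 ^ k * ∫ ω, ladderSum ξ A κ α k ω ∂μ
      = ∑ j, ∑ l ∈ A j, ∑ k ∈ Finset.range (N + 1),
        α * 4 ^ k * ∫ ω, |ξ j ω| * ((κ j)⁻¹ * ladder α k (κ j * |ξ l ω|)) ∂μ := by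
        simp only [e, Finset.mul_sum]
        rw [Finset.sum_comm]
        exact Finset.sum_congr rfl fun j _ => Finset.sum_comm
    _ ≤ ∑ j, ∑ l ∈ A j, 34 * (κ j * ∫ ω, |ξ j ω| * ξ l ω ^ 2 ∂μ) :=
        Finset.sum_le_sum fun j _ => Finset.sum_le_sum fun l hl => hpair j l hl
    _ ≤ _ := by
        have := H.sum_integral_abs_mul_sq_le
        simp only [← Finset.mul_sum] at this ⊢
        linarith

/-- The contribution of the indicator part of the Stein solution. -/
theorem sum_integral_indicator_ladderSum_le {α β δ z : ℝ} (hα : 0 < α) (hβ : 0 < β) {N : ℕ}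
    (hN : α * 4 ^ N ≤ 4)
    (hB1 : ∑ j, κ j ^ 2 * lpNorm (ξ j) 4 μ ^ 3 ≤ β)
    (hB2 : ∑ j, (κ j ^ 3 + κ j * τ j) * lpNorm (ξ j) 4 μ ^ 4 ≤ β ^ 2)
    (hδ : ∀ z, |μ.real {ω | nbhdSum ξ Finset.univ ω ≤ z} - cdf (gaussianReal 0 1) z| ≤ δ) :
    ∑ k ∈ Finset.range (N + 1), ∫ ω,
      (if |nbhdSum ξ Finset.univ ω - z| ≤ 2 * (α * 4 ^ k) then 1 else 0)
        * ladderSum ξ A κ α k ω ∂μ ≤ 358 * β * (1 + δ / α) := by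
  have hQ := H.memLp_dominating
  have hWm : Measurable (nbhdSum ξ Finset.univ) := (H.polyGrowth_nbhdSum _).1
  have hδ0 : 0 ≤ δ := (abs_nonneg _).trans (hδ 0)
  set R := 1 + δ / α with hR
  have hR1 : 1 ≤ R := by have : 0 ≤ δ / α := by positivity
                         linarith
  have hk : ∀ k ∈ Finset.range (N + 1), ∫ ω,
      (if |nbhdSum ξ Finset.univ ω - z| ≤ 2 * (α * 4 ^ k) then 1 else 0)
        * ladderSum ξ A κ α k ω ∂μ
      ≤ 5 * R * (α * 4 ^ k * ∫ ω, ladderSum ξ A κ α k ω ∂μ)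
        + 9 / 2 * β * R * (√α * 2 ^ k) := by
    intro k _
    set s := α * 4 ^ k with hs
    set r := √α * 2 ^ k with hr
    have hr0 : 0 < r := by positivity
    have hs0 : 0 < s := by positivity
    have hrs : r ^ 2 = s := by
      rw [hr, hs, mul_pow, Real.sq_sqrt hα.le, ← pow_mul, mul_comm k 2, pow_mul]
      norm_num
    have hαs : α ≤ s := le_mul_of_one_le_right hα.le (one_le_pow₀ (by norm_num))
    set S : Set Ω := {ω | |nbhdSum ξ Finset.univ ω - z| ≤ 2 * s} with hS
    have hSm : MeasurableSet S :=
      measurableSet_le (hWm.sub_const z).abs measurable_const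
    set χ : Ω → ℝ := fun ω => if |nbhdSum ξ Finset.univ ω - z| ≤ 2 * s then 1 else 0 with hχ
    have hχS : χ = S.indicator 1 := by
      funext ω
      simp [hχ, hS, Set.indicator_apply]
    have hχm : Measurable χ := by rw [hχS]; exact measurable_one.indicator hSm
    have h01 : ∀ ω, χ ω = 0 ∨ χ ω = 1 := fun ω => by
      simp only [hχ]; split_ifs
      · exact Or.inr rfl
      · exact Or.inl rfl
    have hχp : PolyGrowth (dominating ξ) 0 χ := PolyGrowth.of_bounded hχm 1 fun ω => by
      rcases h01 ω with h | h <;> rw [h] <;> simp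
    have hVp := H.polyGrowth_ladderSum hα k
    have hp : ∫ ω, χ ω ∂μ ≤ 5 * s * R := by
      have e1 : ∫ ω, χ ω ∂μ = μ.real S := by rw [hχS, integral_indicator_one hSm]
      rw [e1]
      refine (measureReal_abs_sub_le hWm hδ z hs0).trans ?_
      -- Every scale is at least `α`, so `δ` can be charged proportionally to `s`.
      have : δ ≤ s * (δ / α) := by
        rw [mul_div_assoc', le_div_iff₀ hα]
        nlinarith
      rw [hR]
      nlinarith
    have hV0 : 0 ≤ ∫ ω, ladderSum ξ A κ α k ω ∂μ := by
      refine integral_nonneg fun ω => Finset.sum_nonneg fun j _ => Finset.sum_nonneg fun l _ => ?_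
      have := H.kappa_nonneg j
      exact mul_nonneg (abs_nonneg _) (mul_nonneg (inv_nonneg.2 this)
        (ladder_nonneg hα k (mul_nonneg this (abs_nonneg _))))
    have hvar : Var[ladderSum ξ A κ α k; μ] ≤ 4 * β ^ 2 :=
      (H.variance_ladderSum_le hα k).trans (by linarith)
    -- The parameter `β / r`, with `r = √s`, balances the probability, of order `s R`, against the
    -- variance, of order `β²`; both errors become multiples of `β R √s`.
    have hmain := integral_indicator_mul_le (χ := χ) (V := ladderSum ξ A κ α k) (μ := μ)
      (hχp.integrable hQ (by norm_num)) (hVp.memLp_two hQ le_rfl)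
      ((hχp.mul hVp).integrable hQ (by norm_num)) h01 (r := β / r) (by positivity)
    have t1 := mul_le_mul_of_nonneg_right hp hV0
    have t2 : β / r * ∫ ω, χ ω ∂μ ≤ 5 * β * R * r := by
      refine (mul_le_mul_of_nonneg_left hp (by positivity)).trans (le_of_eq ?_)
      rw [← hrs]
      field_simp
    have t3 : Var[ladderSum ξ A κ α k; μ] / (β / r) ≤ 4 * β * r := by
      rw [div_le_iff₀ (by positivity)]
      refine hvar.trans (le_of_eq ?_)
      field_simp
    have t4 : 4 * β * r ≤ 4 * β * R * r := by
      have := mul_le_mul_of_nonneg_left hR1 (show 0 ≤ 4 * β * r by positivity)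
      linarith
    calc ∫ ω, χ ω * ladderSum ξ A κ α k ω ∂μ ≤ _ := hmain
      _ ≤ 5 * s * R * (∫ ω, ladderSum ξ A κ α k ω ∂μ) + (5 * β * R * r + 4 * β * R * r) / 2 := by
        linarith
      _ = _ := by ring
  have hsum := Finset.sum_le_sum hk
  rw [Finset.sum_add_distrib, ← Finset.mul_sum, ← Finset.mul_sum, ← Finset.mul_sum] at hsum
  have h1 := H.sum_scale_mul_integral_ladderSum_le hα N
  -- The square roots of the scales grow by factors of `2`, so their sum is comparable to the last
  -- one, which is at most `2`. With `h1` this gives `5 · 68 + (9/2) · 4 = 358`.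
  have h2 : √α * ∑ k ∈ Finset.range (N + 1), (2 : ℝ) ^ k ≤ 4 := by
    have e1 : √α * 2 ^ N ≤ 2 := by
      refine abs_le_of_sq_le_sq' ?_ (by norm_num) |>.2
      rw [mul_pow, Real.sq_sqrt hα.le, ← pow_mul, mul_comm N 2, pow_mul]
      norm_num
      exact hN
    have e2 := mul_le_mul_of_nonneg_left (sum_two_pow_le (N + 1)) (Real.sqrt_nonneg α)
    rw [pow_succ] at e2
    linarith
  have h3 : 5 * R * (∑ k ∈ Finset.range (N + 1), α * 4 ^ k * ∫ ω, ladderSum ξ A κ α k ω ∂μ)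
      ≤ 5 * R * (68 * β) :=
    mul_le_mul_of_nonneg_left (h1.trans (by linarith)) (by positivity)
  have h4 : 9 / 2 * β * R * (√α * ∑ k ∈ Finset.range (N + 1), (2 : ℝ) ^ k)
      ≤ 9 / 2 * β * R * 4 := mul_le_mul_of_nonneg_left h2 (by positivity)
  refine hsum.trans ?_
  linarith

end LocallyDependent

/-! ### The Stein identity and the bootstrap. -/

theorem nbhdSum_compl {ι Ω : Type*} [Fintype ι] [DecidableEq ι] (ξ : ι → Ω → ℝ) (s : Finset ι)
    (ω : Ω) : nbhdSum ξ sᶜ ω = nbhdSum ξ Finset.univ ω - nbhdSum ξ s ω := by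
  have := Finset.sum_compl_add_sum s fun m => ξ m ω
  simp only [nbhdSum]
  linarith

namespace LocallyDependent

variable {ι Ω : Type*} [Fintype ι] [DecidableEq ι] [MeasurableSpace Ω]
  {μ : Measure Ω} {ξ : ι → Ω → ℝ} {A : ι → Finset ι} {A₂ : ι → ι → Finset ι} {κ τ : ι → ℝ}
  (H : LocallyDependent μ ξ A A₂ κ τ)
include H

theorem integral_mul_comp_compl_eq_zero {f : ℝ → ℝ} (hf : Measurable f) (j : ι) :
    ∫ ω, ξ j ω * f (nbhdSum ξ (A j)ᶜ ω) ∂μ = 0 := by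
  have hind := (H.indep_compl j).comp (φ := id) (ψ := f) measurable_id hf
  have hm : Measurable fun ω => f (nbhdSum ξ (A j)ᶜ ω) := hf.comp (H.polyGrowth_nbhdSum _).1
  have := hind.integral_fun_mul_eq_mul_integral (H.measurable j).aestronglyMeasurable
    hm.aestronglyMeasurable
  refine this.trans ?_
  have h0 : ∫ ω, (id ∘ ξ j) ω ∂μ = 0 := H.integral_eq_zero j
  rw [h0, zero_mul]

theorem integral_mul_nbhdSum_compl_eq_zero (j : ι) :
    ∫ ω, ξ j ω * nbhdSum ξ (A j)ᶜ ω ∂μ = 0 := by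
  have := (H.indep_compl j).integral_fun_mul_eq_mul_integral
    (H.measurable j).aestronglyMeasurable (H.polyGrowth_nbhdSum (A j)ᶜ).1.aestronglyMeasurable
  refine this.trans ?_
  rw [H.integral_eq_zero j, zero_mul]

variable [IsProbabilityMeasure μ]

/-- The Stein kernel total `∑ j, ξ j * ∑ l ∈ A j, ξ l` is close to `1` in mean. -/
theorem integral_abs_one_sub_le {β : ℝ} (hβ : 0 < β)
    (hW : ∫ ω, nbhdSum ξ Finset.univ ω ^ 2 ∂μ = 1)
    (hB2 : ∑ j, (κ j ^ 3 + κ j * τ j) * lpNorm (ξ j) 4 μ ^ 4 ≤ β ^ 2) :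
    ∫ ω, |1 - ∑ j, ξ j ω * nbhdSum ξ (A j) ω| ∂μ ≤ β := by
  have hQ := H.memLp_dominating
  set T : Ω → ℝ := fun ω => ∑ j, ξ j ω * nbhdSum ξ (A j) ω with hT
  have hTp : PolyGrowth (dominating ξ) 2 T :=
    PolyGrowth.sum _ fun j _ => (H.polyGrowth j).mul (H.polyGrowth_nbhdSum _)
  -- Expanding `W²` as `∑ ξ_j W` leaves `T` plus products of a centred variable with an independent
  -- sum.
  have hET : ∫ ω, T ω ∂μ = 1 := by
    have i1 : ∀ j, Integrable (fun ω => ξ j ω * nbhdSum ξ (A j) ω) μ := fun j =>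
      ((H.polyGrowth j).mul (H.polyGrowth_nbhdSum _)).integrable hQ (by norm_num)
    have i2 : ∀ j, Integrable (fun ω => ξ j ω * nbhdSum ξ (A j)ᶜ ω) μ := fun j =>
      ((H.polyGrowth j).mul (H.polyGrowth_nbhdSum _)).integrable hQ (by norm_num)
    rw [← hW]
    have e : ∀ ω, nbhdSum ξ Finset.univ ω ^ 2
        = T ω + ∑ j, ξ j ω * nbhdSum ξ (A j)ᶜ ω := by
      intro ω
      have h1 : nbhdSum ξ Finset.univ ω = ∑ j, ξ j ω := rfl
      simp only [hT]
      rw [← Finset.sum_add_distrib, sq]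
      conv_lhs => rw [h1, Finset.sum_mul, ← h1]
      exact Finset.sum_congr rfl fun j _ => by rw [nbhdSum_compl]; ring
    simp only [e]
    rw [integral_add (hTp.integrable hQ (by norm_num)) (integrable_finsetSum _ fun j _ => i2 j),
      integral_finsetSum _ fun j _ => i2 j]
    simp only [H.integral_mul_nbhdSum_compl_eq_zero, Finset.sum_const_zero, add_zero]
  have hvar : Var[T; μ] ≤ β ^ 2 := by
    have h := H.variance_sum_pairs_le (G := fun _ _ t => t.1 * t.2) (c := 1)
      (fun j l => measurable_fst.mul measurable_snd) (fun j l _ t => by simp)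
    simp only [H.integral_pow_four_eq, one_pow, one_mul] at h
    refine le_trans (le_of_eq ?_) (h.trans hB2)
    congr 1
    funext ω
    simp only [hT, nbhdSum, Finset.mul_sum]
  rw [variance_eq_integral hTp.1.aemeasurable, hET] at hvar
  have i0 : Integrable (fun ω => (T ω - 1) ^ 2) μ :=
    ((hTp.sub (PolyGrowth.const 1)).pow 2).integrable hQ le_rfl
  calc ∫ ω, |1 - T ω| ∂μ ≤ ∫ ω, β / 2 + (T ω - 1) ^ 2 / (2 * β) ∂μ := by
        refine integral_mono (((PolyGrowth.const 1).sub hTp).abs.integrable hQ (by norm_num))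
          ((integrable_const _).add (i0.div_const _)) fun ω => ?_
        simp only
        rw [abs_sub_comm]
        -- A square completion in place of Cauchy–Schwarz: `|x| ≤ β/2 + x²/(2β)`.
        have e : β / 2 + (T ω - 1) ^ 2 / (2 * β) - |T ω - 1| = (|T ω - 1| - β) ^ 2 / (2 * β) := by
          rw [← sq_abs (T ω - 1)]
          field_simp
          ring
        have : 0 ≤ (|T ω - 1| - β) ^ 2 / (2 * β) := by positivity
        linarith
    _ = β / 2 + (∫ ω, (T ω - 1) ^ 2 ∂μ) / (2 * β) := by
        rw [integral_add (integrable_const _) (i0.div_const _), integral_div (2 * β)]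
        simp
    _ ≤ β / 2 + β ^ 2 / (2 * β) := by gcongr
    _ = β := by field_simp; ring

theorem abs_integral_ramp_sub_le {α β δ : ℝ} (hα : 0 < α) (hα1 : α ≤ 1) (hβ : 0 < β)
    (hβ1 : β ≤ 1) (hW : ∫ ω, nbhdSum ξ Finset.univ ω ^ 2 ∂μ = 1)
    (hB1 : ∑ j, κ j ^ 2 * lpNorm (ξ j) 4 μ ^ 3 ≤ β)
    (hB2 : ∑ j, (κ j ^ 3 + κ j * τ j) * lpNorm (ξ j) 4 μ ^ 4 ≤ β ^ 2)
    (hδ : ∀ z, |μ.real {ω | nbhdSum ξ Finset.univ ω ≤ z} - cdf (gaussianReal 0 1) z| ≤ δ)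
    (z : ℝ) :
    |(∫ ω, ramp z α (nbhdSum ξ Finset.univ ω) ∂μ) - ∫ x, ramp z α x ∂(gaussianReal 0 1)|
      ≤ 388 * β * (1 + δ / α) := by
  have hQ := H.memLp_dominating
  obtain ⟨f, f', hd, heq, hf, hf'⟩ :=
    exists_stein_solution (continuous_ramp z α) (ramp_nonneg z α) (ramp_le_one z α)
  set c := ∫ x, ramp z α x ∂(gaussianReal 0 1) with hc
  set W := nbhdSum ξ Finset.univ with hWdef
  set Y : ι → Ω → ℝ := fun j => nbhdSum ξ (A j) with hY
  set T : Ω → ℝ := fun ω => ∑ j, ξ j ω * Y j ω with hT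
  have hWp : PolyGrowth (dominating ξ) 1 W := H.polyGrowth_nbhdSum _
  have hYp : ∀ j, PolyGrowth (dominating ξ) 1 (Y j) := fun j => H.polyGrowth_nbhdSum _
  have hTp : PolyGrowth (dominating ξ) 2 T :=
    PolyGrowth.sum _ fun j _ => (H.polyGrowth j).mul (hYp j)
  have hfc : Continuous f := continuous_iff_continuousAt.2 fun w => (hd w).continuousAt
  have hfc' : Continuous f' := by
    have e : f' = fun w => w * f w + ramp z α w - c := funext heq
    rw [e]
    exact ((continuous_id.mul hfc).add (continuous_ramp z α)).sub continuous_const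
  have hfW : PolyGrowth (dominating ξ) 0 fun ω => f' (W ω) :=
    PolyGrowth.of_bounded (hfc'.measurable.comp hWp.1) 2 fun ω => hf' _
  have hfR : ∀ j, PolyGrowth (dominating ξ) 0 fun ω => f (nbhdSum ξ (A j)ᶜ ω) := fun j =>
    PolyGrowth.of_bounded (hfc.measurable.comp (H.polyGrowth_nbhdSum _).1) 5 fun ω => hf _
  have hfW0 : PolyGrowth (dominating ξ) 0 fun ω => f (W ω) :=
    PolyGrowth.of_bounded (hfc.measurable.comp hWp.1) 5 fun ω => hf _
  set r : ι → Ω → ℝ := fun j ω => f (W ω) - f (nbhdSum ξ (A j)ᶜ ω) - Y j ω * f' (W ω) with hr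
  have hrp : ∀ j, PolyGrowth (dominating ξ) 1 (r j) := fun j =>
    ((hfW0.sub (hfR j)).mono (Nat.zero_le 1)).sub ((hYp j).mul hfW)
  -- The Stein equation at `W`, with each `ξ_j f(W)` expanded around `W - Y_j`. The middle sum has
  -- mean zero.
  have hpt : ∀ ω, ramp z α (W ω) - c
      = f' (W ω) * (1 - T ω) - ∑ j, ξ j ω * f (nbhdSum ξ (A j)ᶜ ω) - ∑ j, ξ j ω * r j ω := by
    intro ω
    have h1 : W ω = ∑ j, ξ j ω := rfl
    have h2 : W ω * f (W ω) = T ω * f' (W ω) + ∑ j, ξ j ω * f (nbhdSum ξ (A j)ᶜ ω)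
        + ∑ j, ξ j ω * r j ω := by
      simp only [hT]
      rw [Finset.sum_mul, ← Finset.sum_add_distrib, ← Finset.sum_add_distrib]
      conv_lhs => rw [h1, Finset.sum_mul, ← h1]
      exact Finset.sum_congr rfl fun j _ => by simp only [hr]; ring
    have h3 := heq (W ω)
    linarith
  have iA : Integrable (fun ω => f' (W ω) * (1 - T ω)) μ :=
    (hfW.mul ((PolyGrowth.const 1).sub hTp)).integrable hQ (by norm_num)
  have iB : ∀ j, Integrable (fun ω => ξ j ω * f (nbhdSum ξ (A j)ᶜ ω)) μ := fun j =>
    ((H.polyGrowth j).mul (hfR j)).integrable hQ (by norm_num)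
  have iC : ∀ j, Integrable (fun ω => ξ j ω * r j ω) μ := fun j =>
    ((H.polyGrowth j).mul (hrp j)).integrable hQ (by norm_num)
  have hident : (∫ ω, ramp z α (W ω) ∂μ) - c
      = (∫ ω, f' (W ω) * (1 - T ω) ∂μ) - ∫ ω, ∑ j, ξ j ω * r j ω ∂μ := by
    have e1 : (∫ ω, ramp z α (W ω) ∂μ) - c = ∫ ω, (ramp z α (W ω) - c) ∂μ := by
      rw [integral_sub (integrable_ramp hWp.1 z α) (integrable_const c)]
      simp
    rw [e1]
    simp only [hpt]
    have iBs := integrable_finsetSum Finset.univ fun j _ => iB j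
    have iAB : Integrable
        (fun ω => f' (W ω) * (1 - T ω) - ∑ j, ξ j ω * f (nbhdSum ξ (A j)ᶜ ω)) μ := iA.sub iBs
    rw [integral_sub iAB (integrable_finsetSum _ fun j _ => iC j), integral_sub iA iBs,
      integral_finsetSum _ fun j _ => iB j]
    simp only [H.integral_mul_comp_compl_eq_zero hfc.measurable, Finset.sum_const_zero,
      sub_zero]
  have hfirst : |∫ ω, f' (W ω) * (1 - T ω) ∂μ| ≤ 2 * β := by
    have iT : Integrable (fun ω => |1 - T ω|) μ :=
      ((PolyGrowth.const 1).sub hTp).abs.integrable hQ (by norm_num)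
    calc |∫ ω, f' (W ω) * (1 - T ω) ∂μ| ≤ ∫ ω, |f' (W ω) * (1 - T ω)| ∂μ :=
          abs_integral_le_integral_abs
      _ ≤ ∫ ω, 2 * |1 - T ω| ∂μ := by
          refine integral_mono iA.abs (iT.const_mul 2) fun ω => ?_
          simp only
          rw [abs_mul]
          exact mul_le_mul_of_nonneg_right (hf' _) (abs_nonneg _)
      _ ≤ 2 * β := by
          rw [integral_const_mul]
          linarith [H.integral_abs_one_sub_le hβ hW hB2]
  -- `N = n + 1` is chosen so that `1 < α 4 ^ N ≤ 4`: the scales reach `1`, as the increment bound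
  -- requires, yet stay bounded, as the sum of their roots requires.
  obtain ⟨n, hn1, hn2⟩ := exists_nat_pow_near (x := 1 / α) (y := 4)
    ((one_le_div hα).2 hα1) (by norm_num)
  rw [le_div_iff₀ hα, mul_comm] at hn1
  rw [div_lt_iff₀ hα, mul_comm] at hn2
  set N := n + 1 with hN
  have hN4 : α * 4 ^ N ≤ 4 := by rw [hN, pow_succ]; linarith
  set χ : ℕ → Ω → ℝ := fun k ω => if |W ω - z| ≤ 2 * (α * 4 ^ k) then 1 else 0 with hχ
  have hχp : ∀ k, PolyGrowth (dominating ξ) 0 (χ k) := fun k => by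
    refine PolyGrowth.of_bounded (Measurable.ite (measurableSet_le (hWp.1.sub_const z).abs
      measurable_const) measurable_const measurable_const) 1 fun ω => ?_
    simp only [hχ]
    split_ifs <;> simp
  have hχ0 : ∀ k ω, 0 ≤ χ k ω := fun k ω => by
    simp only [hχ]
    split_ifs <;> simp
  have hrle : ∀ j ω, |ξ j ω * r j ω| ≤ 6 * (|ξ j ω| * Y j ω ^ 2)
      + 2 * (|ξ j ω| * Y j ω ^ 2 * |W ω|)
      + ∑ k ∈ Finset.range (N + 1), χ k ω * (|ξ j ω| * ladder α k |Y j ω|) := by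
    intro j ω
    obtain ⟨D, hD1, hD2⟩ := exists_ramp_increment_bound (z := z) hα hn2.le (W ω) (Y j ω)
    have h := stein_remainder_le hd heq hf hf' (W ω) (Y j ω) D hD1
    have e : W ω - Y j ω = nbhdSum ξ (A j)ᶜ ω := (nbhdSum_compl ξ (A j) ω).symm
    rw [e] at h
    rw [abs_mul]
    refine (mul_le_mul_of_nonneg_left (h.trans (add_le_add_right hD2 _)) (abs_nonneg _)).trans
      (le_of_eq ?_)
    simp only [mul_add, Finset.mul_sum]
    have : ∀ k ∈ Finset.range (N + 1), |ξ j ω| *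
        ((if |W ω - z| ≤ 2 * (α * 4 ^ k) then 1 else 0) * ladder α k |Y j ω|)
        = χ k ω * (|ξ j ω| * ladder α k |Y j ω|) := fun k _ => by simp only [hχ]; ring
    rw [Finset.sum_congr rfl this]
    ring
  have i1 : ∀ j, Integrable (fun ω => |ξ j ω| * Y j ω ^ 2) μ := fun j =>
    ((H.polyGrowth j).abs.mul ((hYp j).pow 2)).integrable hQ (by norm_num)
  have i2 : ∀ j, Integrable (fun ω => |ξ j ω| * Y j ω ^ 2 * |W ω|) μ := fun j =>
    (((H.polyGrowth j).abs.mul ((hYp j).pow 2)).mul hWp.abs).integrable hQ le_rfl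
  have i3 : ∀ k, Integrable (fun ω => χ k ω * ladderSum ξ A κ α k ω) μ := fun k =>
    ((hχp k).mul (H.polyGrowth_ladderSum hα k)).integrable hQ (by norm_num)
  have is1 : Integrable (fun ω => 6 * ∑ j, |ξ j ω| * Y j ω ^ 2) μ :=
    (integrable_finsetSum _ fun j _ => i1 j).const_mul 6
  have is2 : Integrable (fun ω => 2 * ∑ j, |ξ j ω| * Y j ω ^ 2 * |W ω|) μ :=
    (integrable_finsetSum _ fun j _ => i2 j).const_mul 2
  have is3 : Integrable
      (fun ω => ∑ k ∈ Finset.range (N + 1), χ k ω * ladderSum ξ A κ α k ω) μ :=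
    integrable_finsetSum _ fun k _ => i3 k
  have is12 : Integrable (fun ω => 6 * ∑ j, |ξ j ω| * Y j ω ^ 2
      + 2 * ∑ j, |ξ j ω| * Y j ω ^ 2 * |W ω|) μ := is1.add is2
  have hsecond : |∫ ω, ∑ j, ξ j ω * r j ω ∂μ| ≤ 28 * β + 358 * β * (1 + δ / α) := by
    have iCs := integrable_finsetSum Finset.univ fun j _ => iC j
    calc |∫ ω, ∑ j, ξ j ω * r j ω ∂μ| ≤ ∫ ω, |∑ j, ξ j ω * r j ω| ∂μ :=
          abs_integral_le_integral_abs
      _ ≤ ∫ ω, 6 * ∑ j, |ξ j ω| * Y j ω ^ 2 + 2 * ∑ j, |ξ j ω| * Y j ω ^ 2 * |W ω|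
          + ∑ k ∈ Finset.range (N + 1), χ k ω * ladderSum ξ A κ α k ω ∂μ := by
          refine integral_mono iCs.abs (is12.add is3) fun ω => ?_
          refine (Finset.abs_sum_le_sum_abs _ _).trans
            ((Finset.sum_le_sum fun j _ => hrle j ω).trans ?_)
          rw [Finset.sum_add_distrib, Finset.sum_add_distrib, ← Finset.mul_sum, ← Finset.mul_sum,
            Finset.sum_comm]
          refine add_le_add le_rfl (Finset.sum_le_sum fun k _ => ?_)
          rw [← Finset.mul_sum]
          exact mul_le_mul_of_nonneg_left (H.sum_abs_mul_ladder_nbhdSum_le hα k ω) (hχ0 k ω)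
      _ = 6 * ∑ j, ∫ ω, |ξ j ω| * Y j ω ^ 2 ∂μ + 2 * ∑ j, ∫ ω, |ξ j ω| * Y j ω ^ 2 * |W ω| ∂μ
          + ∑ k ∈ Finset.range (N + 1), ∫ ω, χ k ω * ladderSum ξ A κ α k ω ∂μ := by
          rw [integral_add is12 is3, integral_add is1 is2, integral_const_mul, integral_const_mul,
            integral_finsetSum _ fun j _ => i1 j, integral_finsetSum _ fun j _ => i2 j,
            integral_finsetSum _ fun k _ => i3 k]
      _ ≤ 28 * β + 358 * β * (1 + δ / α) := by
          have h1 := H.sum_integral_abs_mul_sq_nbhdSum_le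
          have h2 := H.sum_integral_abs_mul_sq_nbhdSum_mul_abs_le hW
          have h3 := H.sum_integral_indicator_ladderSum_le (z := z) hα hβ hN4 hB1 hB2 hδ
          -- The smooth part totals `6 · 2β + 2 (2β + 6β²)`, at most `28 β` since `β ≤ 1`.
          have h4 : β ^ 2 ≤ β := by nlinarith
          linarith
  have hδ0 : 0 ≤ δ / α := div_nonneg ((abs_nonneg _).trans (hδ 0)) hα.le
  rw [hident]
  refine (abs_sub _ _).trans ?_
  nlinarith [mul_nonneg hβ.le hδ0]

/-- Berry–Esseen bound for a normalised sum of locally dependent variables. -/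
theorem abs_measureReal_sub_cdf_le {β : ℝ} (hβ : 0 < β)
    (hW : ∫ ω, nbhdSum ξ Finset.univ ω ^ 2 ∂μ = 1)
    (hB1 : ∑ j, κ j ^ 2 * lpNorm (ξ j) 4 μ ^ 3 ≤ β)
    (hB2 : ∑ j, (κ j ^ 3 + κ j * τ j) * lpNorm (ξ j) 4 μ ^ 4 ≤ β ^ 2) (z : ℝ) :
    |μ.real {ω | nbhdSum ξ Finset.univ ω ≤ z} - cdf (gaussianReal 0 1) z| ≤ 2400 * β := by
  have h1 : ∀ z, |μ.real {ω | nbhdSum ξ Finset.univ ω ≤ z} - cdf (gaussianReal 0 1) z| ≤ 1 :=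
    fun z => abs_le.2 ⟨by
      linarith [measureReal_nonneg (μ := μ) (s := {ω | nbhdSum ξ Finset.univ ω ≤ z}),
        cdf_le_one (gaussianReal 0 1) z], by
      linarith [measureReal_le_one (μ := μ) (s := {ω | nbhdSum ξ Finset.univ ω ≤ z}),
        cdf_nonneg (gaussianReal 0 1) z]⟩
  -- For `800 β > 1` the claim is weaker than the trivial bound `1`. Otherwise `α = 800 β` is an
  -- admissible width.
  rcases lt_or_ge 1 (800 * β) with hbig | hsmall
  · linarith [h1 z]
  set δ := ⨆ z, |μ.real {ω | nbhdSum ξ Finset.univ ω ≤ z} - cdf (gaussianReal 0 1) z| with hδdef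
  have hbdd : BddAbove (Set.range fun z =>
      |μ.real {ω | nbhdSum ξ Finset.univ ω ≤ z} - cdf (gaussianReal 0 1) z|) :=
    ⟨1, by rintro _ ⟨z, rfl⟩; exact h1 z⟩
  have hδ : ∀ z, |μ.real {ω | nbhdSum ξ Finset.univ ω ≤ z} - cdf (gaussianReal 0 1) z| ≤ δ :=
    fun z => le_ciSup hbdd z
  have hα : 0 < 800 * β := by linarith
  have hsm := fun z => H.abs_integral_ramp_sub_le hα hsmall hβ (by linarith) hW hB1 hB2 hδ z
  have hz := fun z => abs_measureReal_sub_cdf_le_of_smooth (H.polyGrowth_nbhdSum _).1 hα hsm z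
  -- The self-bounding inequality reads `δ ≤ 1188 β + (388/800) δ`, hence `δ ≤ 2400 β`.
  have hδle : δ ≤ 800 * β + 388 * β * (1 + δ / (800 * β)) := ciSup_le hz
  have e : 388 * β * (1 + δ / (800 * β)) = 388 * β + 388 / 800 * δ := by field_simp
  rw [e] at hδle
  have hδ0 : 0 ≤ δ := (abs_nonneg _).trans (hδ z)
  linarith [hδ z]

end LocallyDependent

/-! ### Block-structured families -/

/-- The index type of a block-structured family. -/
abbrev BlockIdx {k : ℕ} (J : Fin k → Finset ℕ+) : Type := Σ i : Fin k, {j // j ∈ J i}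

/-- The indices of block `i` whose second coordinate lies in `B`. -/
def blockFinset {k : ℕ} (J : Fin k → Finset ℕ+) (i : Fin k) (B : Finset ℕ+) :
    Finset (BlockIdx J) :=
  Finset.univ.filter fun q => q.1 = i ∧ q.2.1 ∈ B

theorem mem_blockFinset {k : ℕ} {J : Fin k → Finset ℕ+} {i : Fin k} {B : Finset ℕ+}
    {q : BlockIdx J} : q ∈ blockFinset J i B ↔ q.1 = i ∧ q.2.1 ∈ B := by
  simp [blockFinset]

theorem blockIdx_ext {k : ℕ} {J : Fin k → Finset ℕ+} {p q : BlockIdx J} (h1 : p.1 = q.1)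
    (h2 : p.2.1 = q.2.1) : p = q := by
  obtain ⟨i, j, hj⟩ := p
  obtain ⟨i', j', hj'⟩ := q
  simp only at h1 h2
  subst h1
  subst h2
  rfl

theorem card_blockFinset_le {k : ℕ} (J : Fin k → Finset ℕ+) (i : Fin k) (B : Finset ℕ+) :
    (blockFinset J i B).card ≤ B.card := by
  refine Finset.card_le_card_of_injOn (fun q => q.2.1) (fun q hq => (mem_blockFinset.1 hq).2) ?_
  intro p hp q hq h
  exact blockIdx_ext ((mem_blockFinset.1 hp).1.trans (mem_blockFinset.1 hq).1.symm) h

theorem mem_outsideBlock {k : ℕ} {J : Fin k → Finset ℕ+} {i : Fin k} {B : Finset ℕ+}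
    {q : BlockIdx J} (hq : q ∉ blockFinset J i B) : (q.1, q.2.1) ∈ outsideBlock J i B :=
  ⟨q.2.2, fun h => hq (mem_blockFinset.2 h)⟩

theorem blockSum_eq {k : ℕ} {Ω : Type*} (J : Fin k → Finset ℕ+) (X : Fin k → ℕ+ → Ω → ℝ)
    (c : ℝ) (ω : Ω) :
    nbhdSum (fun (t : BlockIdx J) ω => c * X t.1 t.2.1 ω) Finset.univ ω = c * blockSum J X ω := by
  simp only [nbhdSum, blockSum, Finset.mul_sum]
  rw [Fintype.sum_sigma]
  exact Finset.sum_congr rfl fun i _ => Finset.sum_coe_sort (J i) fun j => c * X i j ω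

theorem exists_sum_eq_comp_subfamily {k : ℕ} {Ω : Type*} {J : Fin k → Finset ℕ+}
    (X : Fin k → ℕ+ → Ω → ℝ) (c : ℝ) {T : Set (Fin k × ℕ+)} (s : Finset (BlockIdx J))
    (hs : ∀ q ∈ s, (q.1, q.2.1) ∈ T) :
    ∃ ψ : (T → ℝ) → ℝ, Measurable ψ ∧
      (fun ω => ∑ q ∈ s, c * X q.1 q.2.1 ω) = ψ ∘ subfamily X T := by
  refine ⟨fun v => ∑ q ∈ s.attach, c * v ⟨(q.1.1, q.1.2.1), hs q.1 q.2⟩, ?_, ?_⟩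
  · refine Finset.measurable_sum _ fun q _ => ?_
    have : Measurable fun v : T → ℝ => v ⟨(q.1.1, q.1.2.1), hs q.1 q.2⟩ := measurable_pi_apply _
    exact this.const_mul c
  · funext ω
    simp only [Function.comp_apply, subfamily]
    exact (Finset.sum_attach s fun q => c * X q.1 q.2.1 ω).symm

section Sizes

variable {k : ℕ} {J : Fin k → Finset ℕ+} {A : Fin k → ℕ+ → Finset ℕ+}
  {A₂ : Fin k → ℕ+ → ℕ+ → Finset ℕ+}

theorem card_second_le_blockKappa {i : Fin k} {j l : ℕ+} (hj : j ∈ J i) (hl : l ∈ A i j) :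
    (A₂ i j l).card ≤ blockKappa J A A₂ i := by
  refine le_trans ?_ (le_max_right _ _)
  exact (Finset.le_sup (f := fun l => (A₂ i j l).card) hl).trans
    (Finset.le_sup (f := fun j => (A i j).sup fun l => (A₂ i j l).card) hj)

theorem card_le_blockKappa (hsub : ∀ i, ∀ j ∈ J i, ∀ l ∈ A i j, A i j ⊆ A₂ i j l) {i : Fin k}
    {j : ℕ+} (hj : j ∈ J i) : (A i j).card ≤ blockKappa J A A₂ i := by
  rcases (A i j).eq_empty_or_nonempty with h | ⟨l, hl⟩
  · simp [h]
  · exact (Finset.card_le_card (hsub i j hj l hl)).trans (card_second_le_blockKappa hj hl)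

theorem card_blockN_le_blockKappa {i : Fin k} {j : ℕ+} (hj : j ∈ J i) :
    (blockN J A i j).card ≤ blockKappa J A A₂ i :=
  (Finset.le_sup (f := fun j => (blockN J A i j).card) hj).trans (le_max_left _ _)

end Sizes

theorem mem_pairs {k : ℕ} {J : Fin k → Finset ℕ+} {A : Fin k → ℕ+ → Finset ℕ+}
    {A₂ : Fin k → ℕ+ → ℕ+ → Finset ℕ+} {t a b : BlockIdx J}
    (h1 : b ∈ blockFinset J a.1 (A a.1 a.2.1)) (h2 : t ∈ blockFinset J a.1 (A₂ a.1 a.2.1 b.2.1)) :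
    a.1 = t.1 ∧ b.1 = t.1 ∧ b.2.1 ∈ A t.1 a.2.1 ∧ t.2.1 ∈ A₂ t.1 a.2.1 b.2.1 := by
  obtain ⟨i, a⟩ := a
  obtain ⟨a1, a2⟩ := mem_blockFinset.1 h1
  obtain ⟨b1, b2⟩ := mem_blockFinset.1 h2
  simp only at a1 a2 b1 b2
  subst b1
  exact ⟨rfl, a1, a2, b2⟩

theorem card_pairs_le_blockTau {k : ℕ} {J : Fin k → Finset ℕ+} (A : Fin k → ℕ+ → Finset ℕ+)
    (A₂ : Fin k → ℕ+ → ℕ+ → Finset ℕ+) (t : BlockIdx J) :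
    (Finset.univ.filter fun x : BlockIdx J × BlockIdx J =>
      x.2 ∈ blockFinset J x.1.1 (A x.1.1 x.1.2.1) ∧
        t ∈ blockFinset J x.1.1 (A₂ x.1.1 x.1.2.1 x.2.2.1)).card ≤ blockTau J A A₂ t.1 := by
  set P := Finset.univ.filter fun x : BlockIdx J × BlockIdx J =>
      x.2 ∈ blockFinset J x.1.1 (A x.1.1 x.1.2.1) ∧
        t ∈ blockFinset J x.1.1 (A₂ x.1.1 x.1.2.1 x.2.2.1) with hP
  set Q := ((J t.1) ×ˢ (J t.1)).filter fun pq : ℕ+ × ℕ+ =>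
    pq.2 ∈ A t.1 pq.1 ∧ t.2.1 ∈ A₂ t.1 pq.1 pq.2 with hQ
  have key : ∀ x ∈ P, x.1.1 = t.1 ∧ x.2.1 = t.1 ∧ x.2.2.1 ∈ A t.1 x.1.2.1 ∧
      t.2.1 ∈ A₂ t.1 x.1.2.1 x.2.2.1 := by
    intro x hx
    rw [hP, Finset.mem_filter] at hx
    exact mem_pairs hx.2.1 hx.2.2
  have hmaps : ∀ x ∈ P, (x.1.2.1, x.2.2.1) ∈ Q := by
    intro x hx
    obtain ⟨e1, e2, e3, e4⟩ := key x hx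
    have m1 := (Finset.ext_iff.1 (congrArg J e1) _).1 x.1.2.2
    have m2 := (Finset.ext_iff.1 (congrArg J e2) _).1 x.2.2.2
    rw [hQ, Finset.mem_filter, Finset.mem_product]
    exact ⟨⟨m1, m2⟩, e3, e4⟩
  have hinj : ∀ x ∈ P, ∀ y ∈ P, (x.1.2.1, x.2.2.1) = (y.1.2.1, y.2.2.1) → x = y := by
    intro x hx y hy hxy
    obtain ⟨e1, e2, -, -⟩ := key x hx
    obtain ⟨f1, f2, -, -⟩ := key y hy
    exact Prod.ext (blockIdx_ext (e1.trans f1.symm) (congrArg Prod.fst hxy))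
      (blockIdx_ext (e2.trans f2.symm) (congrArg Prod.snd hxy))
  have hcard : P.card ≤ Q.card :=
    Finset.card_le_card_of_injOn (fun x => (x.1.2.1, x.2.2.1)) hmaps
      fun x hx y hy h => hinj x hx y hy h
  have hsup : Q.card ≤ blockTau J A A₂ t.1 := by
    rw [blockTau]
    exact Finset.le_sup (f := fun j => (((J t.1) ×ˢ (J t.1)).filter fun pq : ℕ+ × ℕ+ =>
      pq.2 ∈ A t.1 pq.1 ∧ j ∈ A₂ t.1 pq.1 pq.2).card) t.2.2
  exact hcard.trans hsup

/-- All neighbourhoods stay inside one block, so sizes depending only on the block are constant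
along them. The independence of sums and pairs follows because they are measurable functions of the
outside subfamily. -/
theorem locallyDependent_of_blocks {Ω : Type*} [MeasurableSpace Ω] {μ : Measure Ω}
    {k : ℕ} {J : Fin k → Finset ℕ+} {X : Fin k → ℕ+ → Ω → ℝ}
    {A : Fin k → ℕ+ → Finset ℕ+} {A₂ : Fin k → ℕ+ → ℕ+ → Finset ℕ+}
    (hmeas : ∀ i, ∀ j ∈ J i, Measurable (X i j))
    (hint : ∀ i, ∀ j ∈ J i, Integrable (fun ω => |X i j ω| ^ 4) μ)
    (hmean : ∀ i, ∀ j ∈ J i, ∫ ω, X i j ω ∂μ = 0)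
    (h1 : LDD1 μ J X A) (h2 : LDD2 μ J X A A₂) (c : ℝ) :
    LocallyDependent μ (fun (t : BlockIdx J) ω => c * X t.1 t.2.1 ω)
      (fun t => blockFinset J t.1 (A t.1 t.2.1))
      (fun t s => blockFinset J t.1 (A₂ t.1 t.2.1 s.2.1))
      (fun t => (blockKappa J A A₂ t.1 : ℝ)) (fun t => (blockTau J A A₂ t.1 : ℝ)) where
  measurable t := (hmeas t.1 t.2.1 t.2.2).const_mul c
  memLp t := by
    have hm := hmeas t.1 t.2.1 t.2.2
    have : MemLp (X t.1 t.2.1) 4 μ := by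
      rw [← integrable_norm_rpow_iff hm.aestronglyMeasurable (by norm_num) (by norm_num)]
      refine (hint t.1 t.2.1 t.2.2).congr (Filter.Eventually.of_forall fun ω => ?_)
      simp only [Real.norm_eq_abs]
      norm_num
    exact this.const_mul c
  integral_eq_zero t := by
    rw [integral_const_mul, hmean t.1 t.2.1 t.2.2, mul_zero]
  indep_compl t := by
    obtain ⟨ψ, hψ, e⟩ := exists_sum_eq_comp_subfamily X c
      (T := outsideBlock J t.1 (A t.1 t.2.1)) (blockFinset J t.1 (A t.1 t.2.1))ᶜ
      fun q hq => mem_outsideBlock (Finset.mem_compl.1 hq)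
    rw [e]
    exact (h1 t.1 t.2.1 t.2.2).2.comp (φ := fun x => c * x) (measurable_const_mul c) hψ
  indep_pair_compl t s hs := by
    obtain ⟨hs1, hs2⟩ := mem_blockFinset.1 hs
    obtain ⟨ψ, hψ, e⟩ := exists_sum_eq_comp_subfamily X c
      (T := outsideBlock J t.1 (A₂ t.1 t.2.1 s.2.1)) (blockFinset J t.1 (A₂ t.1 t.2.1 s.2.1))ᶜ
      fun q hq => mem_outsideBlock (Finset.mem_compl.1 hq)
    have hX : X s.1 s.2.1 = X t.1 s.2.1 := congrArg (fun i => X i s.2.1) hs1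
    rw [e, hX]
    exact (h2 t.1 t.2.1 t.2.2 s.2.1 hs2).2.2.comp (φ := fun x : ℝ × ℝ => (c * x.1, c * x.2))
      (by fun_prop) hψ
  indep_pair_pair t s hs p hp q hq := by
    obtain ⟨hs1, hs2⟩ := mem_blockFinset.1 hs
    have hX : X s.1 s.2.1 = X t.1 s.2.1 := congrArg (fun i => X i s.2.1) hs1
    rw [hX]
    exact (h2 t.1 t.2.1 t.2.2 s.2.1 hs2).2.2.comp (φ := fun x : ℝ × ℝ => (c * x.1, c * x.2))
      (ψ := fun v => (c * v ⟨_, mem_outsideBlock hp⟩, c * v ⟨_, mem_outsideBlock hq⟩))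
      (by fun_prop) (by fun_prop)
  card_le t := by
    rw [Nat.cast_le]
    exact (card_blockFinset_le _ _ _).trans
      (card_le_blockKappa (fun i j hj l hl => (h2 i j hj l hl).1) t.2.2)
  card_second_le t s hs := by
    rw [Nat.cast_le]
    exact (card_blockFinset_le _ _ _).trans
      (card_second_le_blockKappa t.2.2 (mem_blockFinset.1 hs).2)
  card_inv_le t := by
    rw [Nat.cast_le]
    refine le_trans ?_ (card_blockN_le_blockKappa t.2.2)
    refine (Finset.card_le_card (t := blockFinset J t.1 (blockN J A t.1 t.2.1)) fun q hq => ?_).trans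
      (card_blockFinset_le _ _ _)
    obtain ⟨hq1, hq2⟩ := mem_blockFinset.1 (Finset.mem_filter.1 hq).2
    obtain ⟨i, j, hj⟩ := q
    simp only at hq1 hq2
    subst hq1
    exact mem_blockFinset.2 ⟨rfl, Finset.mem_filter.2 ⟨hj, hq2⟩⟩
  card_pairs_le t := by
    rw [Nat.cast_le]
    exact card_pairs_le_blockTau A A₂ t
  kappa_eq t s hs := by rw [(mem_blockFinset.1 hs).1]
  kappa_second_eq t s _ m hm := by rw [(mem_blockFinset.1 hm).1]
  tau_eq t s hs := by rw [(mem_blockFinset.1 hs).1]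

/-! ### Rescaling to unit variance. -/

theorem proposition5p3 :
    ∃ C : ℝ, 0 < C ∧
      ∀ {Ω : Type*} [MeasurableSpace Ω] (μ : Measure Ω) [IsProbabilityMeasure μ]
        (k : ℕ) (J : Fin k → Finset ℕ+) (X : Fin k → ℕ+ → Ω → ℝ)
        (A : Fin k → ℕ+ → Finset ℕ+) (A₂ : Fin k → ℕ+ → ℕ+ → Finset ℕ+),
        (∀ i, ∀ j ∈ J i, Measurable (X i j)) →
        (∀ i, ∀ j ∈ J i, Integrable (fun ω => |X i j ω| ^ 4) μ) →
        (∀ i, ∀ j ∈ J i, ∫ ω, X i j ω ∂μ = 0) →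
        LDD1 μ J X A →
        LDD2 μ J X A A₂ →
        0 < blockSigma μ J X →
        (⨆ z : ℝ, |μ.real {ω | blockSum J X ω / blockSigma μ J X ≤ z}
            - cdf (gaussianReal 0 1) z|) ≤
          C / blockSigma μ J X ^ 3 *
              ∑ i, ∑ j ∈ J i, (blockKappa J A A₂ i : ℝ) ^ 2 * lpNorm (X i j) 4 μ ^ 3
            + C / blockSigma μ J X ^ 2 *
              √(∑ i, ∑ j ∈ J i,
                  ((blockKappa J A A₂ i : ℝ) ^ 3
                    + (blockKappa J A A₂ i : ℝ) * (blockTau J A A₂ i : ℝ))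
                  * lpNorm (X i j) 4 μ ^ 4) := by
  refine ⟨2400, by norm_num, ?_⟩
  intro Ω _ μ _ k J X A A₂ hmeas hint hmean h1 h2 hσ
  set σ := blockSigma μ J X with hσdef
  have H := locallyDependent_of_blocks hmeas hint hmean h1 h2 σ⁻¹
  have hW : ∫ ω, nbhdSum (fun (t : BlockIdx J) ω => σ⁻¹ * X t.1 t.2.1 ω) Finset.univ ω ^ 2 ∂μ
      = 1 := by
    have hSm : Measurable (blockSum J X) :=
      Finset.measurable_sum _ fun i _ => Finset.measurable_sum _ fun j hj => hmeas i j hj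
    have hXint : ∀ i, ∀ j ∈ J i, Integrable (X i j) μ := fun i j hj => by
      have := ((H.memLp ⟨i, j, hj⟩).integrable (by norm_num)).const_mul σ
      simpa [mul_inv_cancel_left₀ hσ.ne'] using this
    have hS0 : ∫ ω, blockSum J X ω ∂μ = 0 := by
      unfold blockSum
      rw [integral_finsetSum _ fun i _ => integrable_finsetSum _ fun j hj => hXint i j hj]
      refine Finset.sum_eq_zero fun i _ => ?_
      rw [integral_finsetSum _ fun j hj => hXint i j hj]
      exact Finset.sum_eq_zero fun j hj => hmean i j hj
    have hvar := variance_of_integral_eq_zero hSm.aemeasurable hS0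
    have hσ2 : σ ^ 2 = ∫ ω, blockSum J X ω ^ 2 ∂μ := by
      rw [hσdef, blockSigma, Real.sq_sqrt (variance_nonneg _ _), hvar]
    simp only [blockSum_eq, mul_pow]
    rw [integral_const_mul, ← hσ2, inv_pow, inv_mul_cancel₀ (by positivity)]
  have hnorm : ∀ i j, lpNorm (fun ω => σ⁻¹ * X i j ω) 4 μ = σ⁻¹ * lpNorm (X i j) 4 μ := by
    intro i j
    have := lpNorm_const_smul (p := 4) σ⁻¹ (X i j) μ
    rw [coe_nnnorm, Real.norm_eq_abs, abs_of_pos (inv_pos.2 hσ)] at this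
    exact this
  have hsums : ∀ F : Fin k → ℕ+ → ℝ, ∑ t : BlockIdx J, F t.1 t.2.1 = ∑ i, ∑ j ∈ J i, F i j := by
    intro F
    rw [Fintype.sum_sigma]
    exact Finset.sum_congr rfl fun i _ => Finset.sum_coe_sort (J i) fun j => F i j
  set B1 := ∑ i, ∑ j ∈ J i, (blockKappa J A A₂ i : ℝ) ^ 2 * lpNorm (X i j) 4 μ ^ 3 with hB1
  set B2 := ∑ i, ∑ j ∈ J i, ((blockKappa J A A₂ i : ℝ) ^ 3
    + (blockKappa J A A₂ i : ℝ) * (blockTau J A A₂ i : ℝ)) * lpNorm (X i j) 4 μ ^ 4 with hB2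
  have hB1' : ∑ t : BlockIdx J, (blockKappa J A A₂ t.1 : ℝ) ^ 2
      * lpNorm (fun ω => σ⁻¹ * X t.1 t.2.1 ω) 4 μ ^ 3 = B1 / σ ^ 3 := by
    simp only [hnorm]
    rw [hsums fun i j => (blockKappa J A A₂ i : ℝ) ^ 2 * (σ⁻¹ * lpNorm (X i j) 4 μ) ^ 3, hB1]
    simp only [Finset.sum_div]
    exact Finset.sum_congr rfl fun i _ => Finset.sum_congr rfl fun j _ => by field_simp
  have hB2' : ∑ t : BlockIdx J, ((blockKappa J A A₂ t.1 : ℝ) ^ 3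
      + (blockKappa J A A₂ t.1 : ℝ) * (blockTau J A A₂ t.1 : ℝ))
      * lpNorm (fun ω => σ⁻¹ * X t.1 t.2.1 ω) 4 μ ^ 4 = B2 / σ ^ 4 := by
    simp only [hnorm]
    rw [hsums fun i j => ((blockKappa J A A₂ i : ℝ) ^ 3
      + (blockKappa J A A₂ i : ℝ) * (blockTau J A A₂ i : ℝ)) * (σ⁻¹ * lpNorm (X i j) 4 μ) ^ 4, hB2]
    simp only [Finset.sum_div]
    exact Finset.sum_congr rfl fun i _ => Finset.sum_congr rfl fun j _ => by field_simp
  have hB10 : 0 ≤ B1 := Finset.sum_nonneg fun i _ => Finset.sum_nonneg fun j _ =>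
    mul_nonneg (by positivity) (pow_nonneg lpNorm_nonneg 3)
  have hB20 : 0 ≤ B2 := Finset.sum_nonneg fun i _ => Finset.sum_nonneg fun j _ =>
    mul_nonneg (by positivity) (pow_nonneg lpNorm_nonneg 4)
  -- The Berry–Esseen bound needs `β > 0`, while the moment sums are only known to be nonnegative
  -- here; `ε / 2400` is added to `β` to guarantee it.
  refine ciSup_le fun z => le_of_forall_pos_le_add fun ε hε => ?_
  have hset : {ω | blockSum J X ω / σ ≤ z}
      = {ω | nbhdSum (fun (t : BlockIdx J) ω => σ⁻¹ * X t.1 t.2.1 ω) Finset.univ ω ≤ z} := by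
    ext ω
    simp only [Set.mem_ofPred_eq, blockSum_eq, div_eq_inv_mul]
  rw [hset]
  have hq1 : 0 ≤ B1 / σ ^ 3 := by positivity
  have hq2 : 0 ≤ √B2 / σ ^ 2 := by positivity
  have hβ : 0 < B1 / σ ^ 3 + √B2 / σ ^ 2 + ε / 2400 := by positivity
  refine (H.abs_measureReal_sub_cdf_le hβ hW ?_ ?_ z).trans (le_of_eq ?_)
  · rw [hB1']
    linarith [div_pos hε (show (0 : ℝ) < 2400 by norm_num)]
  · rw [hB2']
    have e : B2 / σ ^ 4 = (√B2 / σ ^ 2) ^ 2 := by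
      rw [div_pow, Real.sq_sqrt hB20]
      ring
    rw [e]
    exact pow_le_pow_left₀ hq2
      (by linarith [div_pos hε (show (0 : ℝ) < 2400 by norm_num)]) 2
  · ring
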